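/- Theorem. A $3$-colored complete graph is a complete graph together with an assignment of one of $3$ colors to each of its edges (adjacent edges may receive the same color); a rainbow triangle in it is a set of three vertices whose three connecting edges have pairwise distinct colors. There is an absolute constant $\varepsilon_0 > 0$ such that the following holds for every $0 < \varepsilon \le \varepsilon_0$ and every $n$. If $G$ is an $n$-vertex $3$-colored complete graph with at most $\varepsilon^{36} n^3$ rainbow triangles, then one can change the colors of at most $\varepsilon n^2$ edges of $G$ (using the same $3$ colors) so that the resulting $3$-colored complete graph has no rainbow triangles. -/

import Mathlib

/-- A rainbow triangle of an edge-colored complete graph, as a set of three vertices: the three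
edges spanned by `T` have pairwise distinct colors. -/
def IsRainbowTriangle {V K : Type*} (C : SimpleGraph.TopEdgeLabeling V K) (T : Finset V) : Prop :=
  ∃ (x y z : V) (hxy : (⊤ : SimpleGraph V).Adj x y) (hyz : (⊤ : SimpleGraph V).Adj y z)
    (hxz : (⊤ : SimpleGraph V).Adj x z),
    (T : Set V) = {x, y, z} ∧
    C.get x y hxy ≠ C.get y z hyz ∧
    C.get y z hyz ≠ C.get x z hxz ∧
    C.get x y hxy ≠ C.get x z hxz

/-- The set of all rainbow triangles of an edge-colored complete graph. -/
def rainbowTriangles {V K : Type*} (C : SimpleGraph.TopEdgeLabeling V K) : Set (Finset V) :=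
  {T | IsRainbowTriangle C T}

/-- The set of edges of the complete graph on `V` that have different colors in `C` and `C'`. -/
def recoloredEdges {V K : Type*} (C C' : SimpleGraph.TopEdgeLabeling V K) :
    Set (⊤ : SimpleGraph V).edgeSet :=
  {e | C e ≠ C' e}

/-! By Gallai's theorem (`exists_rainbowTriple_of_connected`), a coloring of at least two vertices
without rainbow triangles has a disconnected color. The proof makes this robust and then recurses on
vertex sets `W`.

Suppose every cut of `W` has density at least `θ` in all three colors. A random sample of
polynomially many vertices (in `1/θ`) is then likely to be connected in each color, hence contains a
rainbow triangle, so `W` itself contains many (`card_pow_three_le_of_cut`). Their number pays for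
recoloring all of `W`.

Otherwise some color `i` has a sparse cut. Partition `W`, allowing some deleted vertices, so as to
minimize a weighted sum of `i`-edges across, deleted vertices and unseparated pairs
(`exists_extremal_partition`). By minimality no class `P` splits cheaply. For a vertex `x` outside
`P`, the `i`-edges between its `j`-neighbors and its `k`-neighbors in `P` form rainbow triangles
with `x`; hence `x` is nearly monochromatic to `P`, unless it lies in many rainbow triangles or
sends many `i`-edges to `P` (`min_colorDeg_le`). Near-monochromatic rows and columns make a whole
pair of classes nearly monochromatic (`min_edgeSum_le`). Coloring each pair by its majority color in
`{j, k}` and recursing inside the classes creates no rainbow triangle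
(`IsBlockMap.exists_coloring`).

The total cost is controlled by three potentials: `a * #W ^ 2`, whose decrease pays for deletions
and crossing `i`-edges; `b` times the rainbow count, where each triple is charged at most once; and
`5 * η * n` per vertex, paid when its class becomes too small to recurse on. The step is
`exists_coloring_of_sparse_cut`, the recursion `exists_coloring_diffSum_le`. -/

open Finset Relation

/-! ### Connectivity in a color and Gallai's theorem. -/

/-- The three pairs of a triple receive pairwise distinct colors. -/
def RainbowTriple {V : Type*} (c : V → V → Fin 3) (x y z : V) : Prop :=
  c x y ≠ c y z ∧ c y z ≠ c x z ∧ c x y ≠ c x z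

/-- Adjacency in color `i` inside the set `S`. -/
def ColorAdj {V : Type*} (c : V → V → Fin 3) (S : Set V) (i : Fin 3) (x y : V) : Prop :=
  x ∈ S ∧ y ∈ S ∧ c x y = i

theorem exists_two_other_colors : ∀ i : Fin 3, ∃ j k : Fin 3, j ≠ i ∧ k ≠ i ∧ j ≠ k := by
  decide

theorem exists_step_of_reflTransGen {V : Type*} {r : V → V → Prop} {x y : V}
    (h : ReflTransGen r x y) (K : Set V) (hx : x ∈ K) (hy : y ∉ K) :
    ∃ a ∈ K, ∃ b, b ∉ K ∧ r a b := by
  induction h with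
  | refl => exact absurd hx hy
  | @tail b d _ hbd ih =>
    by_cases hb : b ∈ K
    · exact ⟨b, hb, d, hy, hbd⟩
    · exact ih hb

/-- Along an `i`-edge inside a component not containing `x`, the two edges back to `x` avoid color
`i`; if they differed, the triple would be rainbow. -/
theorem color_eq_of_reflTransGen {V : Type*} {c : V → V → Fin 3} (hc : ∀ x y, c x y = c y x)
    {S : Set V} {i : Fin 3} {x a b : V} (hx : x ∈ S)
    (hno : ∀ y ∈ S, ∀ z ∈ S, ¬ RainbowTriple c x y z)
    (hxa : ¬ ReflTransGen (ColorAdj c S i) a x)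
    (hab : ReflTransGen (ColorAdj c S i) a b) : c x a = c x b := by
  have hne : ∀ d, d ∈ S → ReflTransGen (ColorAdj c S i) a d → c x d ≠ i := by
    intro d hd had h
    exact hxa (had.tail ⟨hd, hx, by rw [hc]; exact h⟩)
  induction hab with
  | refl => rfl
  | @tail d e had hde ih =>
    rw [ih]
    have h1 := hne d hde.1 had
    have h2 := hne e hde.2.1 (had.tail hde)
    by_contra h3
    refine hno d hde.1 e hde.2.1 ⟨?_, ?_, h3⟩
    · rw [hde.2.2]; exact h1
    · rw [hde.2.2]; exact h2.symm

/-- Gallai's theorem: if each of the three colors is connected on `S`, then `S` contains a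
rainbow triple. -/
theorem exists_rainbowTriple_of_connected {V : Type*} [DecidableEq V] {c : V → V → Fin 3}
    (hc : ∀ x y, c x y = c y x) (S : Finset V) (hS : S.Nontrivial)
    (hconn : ∀ i, ∀ x ∈ S, ∀ y ∈ S, ReflTransGen (ColorAdj c S i) x y) :
    ∃ x ∈ S, ∃ y ∈ S, ∃ z ∈ S, RainbowTriple c x y z := by
  induction S using Finset.induction_on with
  | empty => simp at hS
  | @insert v S hv ih =>
    by_contra hcon
    push Not at hcon
    have hSne : S.Nonempty := by
      rw [nonempty_iff_ne_empty]
      rintro rfl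
      simp at hS
    have hedge : ∀ i, ∃ y ∈ S, c v y = i := by
      intro i
      obtain ⟨w, hw⟩ := hSne
      obtain ⟨a, ha, b, hb, hab⟩ := exists_step_of_reflTransGen
        (hconn i v (mem_insert_self _ _) w (mem_insert_of_mem hw)) {v} rfl
        (by rintro rfl; exact hv hw)
      obtain rfl : a = v := ha
      refine ⟨b, ?_, hab.2.2⟩
      have := hab.2.1
      simp only [coe_insert, Set.mem_insert_iff, mem_coe] at this
      exact this.resolve_left hb
    by_cases htriv : S.Nontrivial
    · by_cases hall : ∀ i, ∀ x ∈ S, ∀ y ∈ S, ReflTransGen (ColorAdj c S i) x y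
      · obtain ⟨x, hx, y, hy, z, hz, h⟩ := ih htriv hall
        exact hcon x (mem_insert_of_mem hx) y (mem_insert_of_mem hy) z (mem_insert_of_mem hz) h
      · push Not at hall
        obtain ⟨i, x₀, hx₀, y₀, hy₀, hxy⟩ := hall
        have hsymm : ∀ a b, ReflTransGen (ColorAdj c S i) a b →
            ReflTransGen (ColorAdj c S i) b a := by
          have : Std.Symm (ColorAdj c S i) :=
            ⟨fun a b h => ⟨h.2.1, h.1, by rw [hc]; exact h.2.2⟩⟩
          intro a b h
          exact Std.Symm.symm _ _ h
        -- Color `i` is disconnected on `S` but connected once `v` is added, so `v` has an `i`-edge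
        -- into every `i`-component of `S`.
        have hout : ∀ y ∈ S, ∃ x ∈ S, ReflTransGen (ColorAdj c S i) y x ∧ c v x = i := by
          intro y hy
          obtain ⟨a, ha, b, hb, hab⟩ := exists_step_of_reflTransGen
            (hconn i y (mem_insert_of_mem hy) v (mem_insert_self _ _))
            {x | x ∈ S ∧ ReflTransGen (ColorAdj c S i) y x} ⟨hy, .refl⟩ (fun h => hv h.1)
          have hbS := hab.2.1
          simp only [coe_insert, Set.mem_insert_iff, mem_coe] at hbS
          rcases hbS with rfl | hbS
          · exact ⟨a, ha.1, ha.2, by rw [hc]; exact hab.2.2⟩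
          · exact absurd ⟨hbS, ha.2.tail ⟨ha.1, hbS, hab.2.2⟩⟩ hb
        have hmono : ∀ x ∈ S, ∀ a b, ¬ ReflTransGen (ColorAdj c S i) a x →
            ReflTransGen (ColorAdj c S i) a b → c x a = c x b := fun x hx a b h1 h2 =>
          color_eq_of_reflTransGen hc (mem_coe.2 hx)
            (fun y hy z hz => hcon x (mem_insert_of_mem hx) y (mem_insert_of_mem hy) z
              (mem_insert_of_mem hz)) h1 h2
        have hne : ∀ a ∈ S, ∀ b ∈ S, ¬ ReflTransGen (ColorAdj c S i) a b → c a b ≠ i :=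
          fun a ha b hb h h' => h (.single ⟨ha, hb, h'⟩)
        have hforce : ∀ a ∈ S, ∀ b ∈ S, c v a = i → c v b ≠ i →
            ¬ ReflTransGen (ColorAdj c S i) a b → c a b = c v b := by
          intro a ha b hb h1 h2 h3
          by_contra h4
          have h5 := hne a ha b hb h3
          refine hcon v (mem_insert_self _ _) a (mem_insert_of_mem ha) b (mem_insert_of_mem hb)
            ⟨?_, h4, ?_⟩
          · rw [h1]; exact h5.symm
          · rw [h1]; exact h2.symm
        obtain ⟨j, k, hji, hki, hjk⟩ : ∃ j k : Fin 3, j ≠ i ∧ k ≠ i ∧ j ≠ k :=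
          exists_two_other_colors i
        obtain ⟨y, hy, hvy⟩ := hedge j
        obtain ⟨z, hz, hvz⟩ := hedge k
        have hyi : c v y ≠ i := by rw [hvy]; exact hji
        have hzi : c v z ≠ i := by rw [hvz]; exact hki
        -- If `y` and `z` share a component, an `i`-neighbor `x` of `v` in another component sees it
        -- in both `j` and `k`. Otherwise `i`-neighbors of `v` in the two components force `c y z`
        -- to be both `k` and `j`.
        by_cases hyz : ReflTransGen (ColorAdj c S i) y z
        · obtain ⟨w, hw, hyw⟩ : ∃ w ∈ S, ¬ ReflTransGen (ColorAdj c S i) y w := by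
            by_contra! h
            exact hxy ((hsymm _ _ (h x₀ hx₀)).trans (h y₀ hy₀))
          obtain ⟨x, hx, hwx, hvx⟩ := hout w hw
          have hxy' : ¬ ReflTransGen (ColorAdj c S i) x y :=
            fun h => hyw (hsymm _ _ (hwx.trans h))
          have hxz' : ¬ ReflTransGen (ColorAdj c S i) x z :=
            fun h => hxy' (h.trans (hsymm _ _ hyz))
          have h1 := hforce x hx y hy hvx hyi hxy'
          have h2 := hforce x hx z hz hvx hzi hxz'
          have h3 := hmono x hx y z (fun h => hxy' (hsymm _ _ h)) hyz
          rw [h1, h2, hvy, hvz] at h3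
          exact hjk h3
        · obtain ⟨p, hp, hyp, hvp⟩ := hout y hy
          obtain ⟨q, hq, hzq, hvq⟩ := hout z hz
          have h1 := hforce p hp z hz hvp hzi (fun h => hyz (hyp.trans h))
          have h2 := hforce q hq y hy hvq hyi (fun h => hyz (hsymm _ _ (hzq.trans h)))
          have h3 := hmono z hz y p hyz hyp
          have h4 := hmono y hy z q (fun h => hyz (hsymm _ _ h)) hzq
          rw [hc z p, h1, hvz] at h3
          rw [hc y q, h2, hvy, hc y z, h3] at h4
          exact hjk h4.symm
    · obtain ⟨w, rfl⟩ := hSne.exists_eq_singleton_or_nontrivial.resolve_right htriv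
      obtain ⟨y, hy, h0⟩ := hedge 0
      obtain ⟨z, hz, h1⟩ := hedge 1
      rw [mem_singleton] at hy hz
      rw [hy] at h0
      rw [hz, h0] at h1
      exact absurd h1 (by decide)

/-! ### Random sampling when all cuts are dense. -/

/-- The number of pairs in `A × B` of color `i`. -/
noncomputable def edgeSum {V : Type*} (c : V → V → Fin 3) (i : Fin 3) (A B : Finset V) : ℝ :=
  ∑ x ∈ A, ∑ y ∈ B, if c x y = i then 1 else 0

/-- The number of ordered rainbow triples inside `W`. -/
noncomputable def rainbowSum {V : Type*} (c : V → V → Fin 3) (W : Finset V) : ℝ :=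
  open Classical in ∑ x ∈ W, ∑ y ∈ W, ∑ z ∈ W, if RainbowTriple c x y z then 1 else 0

theorem sum_fin_succ_fun {U : Type*} [Fintype U] {k : ℕ} (F : (Fin (k + 1) → U) → ℝ) :
    ∑ f, F f = ∑ x, ∑ g : Fin k → U, F (Fin.cons x g) := by
  rw [← (Fin.consEquiv (fun _ : Fin (k + 1) => U)).sum_comp, Fintype.sum_prod_type]
  rfl

theorem sum_fin_insertNth {U : Type*} [Fintype U] {k : ℕ} (j : Fin (k + 1)) (F : (Fin (k + 1) → U) → ℝ) :
    ∑ f, F f = ∑ x, ∑ g : Fin k → U, F (j.insertNth x g) := by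
  rw [← (Fin.insertNthEquiv (fun _ : Fin (k + 1) => U) j).sum_comp, Fintype.sum_prod_type]
  rfl

-- A sample is determined by its values at `a`, `b`, `d` and by its restriction to the other
-- positions.
open Classical in
theorem card_filter_triple_mul_le {U : Type*} [Fintype U] {n : ℕ} (P : U → U → U → Prop) {a b d : Fin n} (hab : a ≠ b)
    (had : a ≠ d) (hbd : b ≠ d) :
    (#(univ.filter fun f : Fin n → U => P (f a) (f b) (f d)) : ℝ) * Fintype.card U ^ 3 ≤
      #(univ.filter fun p : U × U × U => P p.1 p.2.1 p.2.2) * Fintype.card U ^ n := by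
  have hcard : Fintype.card {x : Fin n // x ∉ ({a, b, d} : Finset (Fin n))} + 3 = n := by
    have h3 : #({a, b, d} : Finset (Fin n)) = 3 := card_eq_three.2 ⟨a, b, d, hab, had, hbd, rfl⟩
    have h4 := Fintype.card_subtype_compl (fun x => x ∈ ({a, b, d} : Finset (Fin n)))
    have h5 := card_le_univ ({a, b, d} : Finset (Fin n))
    rw [Fintype.card_coe, h3, Fintype.card_fin] at h4
    rw [h3, Fintype.card_fin] at h5
    omega
  have h := card_le_card_of_injOn
    (s := univ.filter fun f : Fin n → U => P (f a) (f b) (f d))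
    (t := (univ.filter fun p : U × U × U => P p.1 p.2.1 p.2.2) ×ˢ
      (univ : Finset ({x : Fin n // x ∉ ({a, b, d} : Finset (Fin n))} → U)))
    (fun f => ((f a, f b, f d), fun x => f x))
    (by intro f hf; simpa using hf)
    (by
      intro f _ g _ hfg
      simp only [Prod.mk.injEq] at hfg
      obtain ⟨⟨h1, h2, h3⟩, h4⟩ := hfg
      funext x
      by_cases hx : x ∈ ({a, b, d} : Finset (Fin n))
      · simp only [mem_insert, mem_singleton] at hx
        rcases hx with rfl | rfl | rfl <;> assumption
      · exact congrFun h4 ⟨x, hx⟩)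
  rw [card_product, card_univ, Fintype.card_fun] at h
  have h' : (#(univ.filter fun f : Fin n → U => P (f a) (f b) (f d)) : ℝ) ≤
      #(univ.filter fun p : U × U × U => P p.1 p.2.1 p.2.2) *
        (Fintype.card U : ℝ) ^ Fintype.card {x : Fin n // x ∉ ({a, b, d} : Finset (Fin n))} := by
    exact_mod_cast h
  calc _ ≤ _ := mul_le_mul_of_nonneg_right h' (by positivity)
    _ = _ := by rw [mul_assoc, ← pow_add, hcard]

section Sampling

variable {U : Type*} [Fintype U] [DecidableEq U]

/-- The vertices reached from `A` when the vertices of the list `f` are explored in order along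
edges of color `i`. -/
def reach (c : U → U → Fin 3) (i : Fin 3) : (k : ℕ) → Finset U → (Fin k → U) → Finset U
  | 0, A, _ => A
  | k + 1, A, f =>
    reach c i k (if f 0 ∈ A then A ∪ univ.filter (fun y => c (f 0) y = i) else A) (Fin.tail f)

/-- Since `#A` is at least `γ` times the number of vertices, at least a `γ ^ 2` proportion of the
unreached set is absorbed on average by one uniform step. The explored set only grows, so the lower
bound on its size persists. -/
theorem sum_card_compl_reach_le {c : U → U → Fin 3} {i : Fin 3} {γ : ℝ} (hγ0 : 0 ≤ γ)
    (hγ1 : γ ≤ 1) (hcut : ∀ A : Finset U, γ * #A * #Aᶜ ≤ edgeSum c i A Aᶜ) (k : ℕ) :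
    ∀ A : Finset U, γ * Fintype.card U ≤ #A →
      ∑ f : Fin k → U, (#(reach c i k A f)ᶜ : ℝ) ≤
        (Fintype.card U * (1 - γ ^ 2)) ^ k * #Aᶜ := by
  have hq : 0 ≤ (Fintype.card U * (1 - γ ^ 2) : ℝ) :=
    mul_nonneg (Nat.cast_nonneg _) (by nlinarith)
  induction k with
  | zero => intro A _; simp [reach]
  | succ k ih =>
    intro A hA
    rw [sum_fin_succ_fun]
    set B : U → Finset U := fun x =>
      if x ∈ A then A ∪ univ.filter (fun y => c x y = i) else A with hB
    have hAB : ∀ x, A ⊆ B x := by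
      intro x
      simp only [hB]
      split_ifs
      · exact subset_union_left
      · exact subset_rfl
    have h1 : ∀ x, ∑ g : Fin k → U, (#(reach c i (k + 1) A (Fin.cons x g))ᶜ : ℝ) ≤
        (Fintype.card U * (1 - γ ^ 2)) ^ k * #(B x)ᶜ := by
      intro x
      simp only [reach, Fin.cons_zero, Fin.tail_cons]
      exact ih (B x) (hA.trans (by exact_mod_cast card_le_card (hAB x)))
    refine (sum_le_sum fun x _ => h1 x).trans ?_
    rw [← mul_sum, pow_succ _ k, mul_assoc]
    refine mul_le_mul_of_nonneg_left ?_ (pow_nonneg hq k)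
    have h2 : ∀ x, (#(B x)ᶜ : ℝ) =
        #Aᶜ - if x ∈ A then ∑ y ∈ Aᶜ, (if c x y = i then (1 : ℝ) else 0) else 0 := by
      intro x
      simp only [hB]
      split_ifs with hx
      · rw [compl_union, sum_boole, eq_sub_iff_add_eq]
        norm_cast
        rw [← card_filter_add_card_filter_not (s := Aᶜ) (fun y => c x y = i), add_comm]
        congr 2
        ext y
        simp
      · simp
    simp_rw [h2]
    rw [sum_sub_distrib, sum_const, card_univ, nsmul_eq_mul, ← sum_filter]
    have h3 := hcut A
    have h4 : edgeSum c i A Aᶜ =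
        ∑ x ∈ univ.filter (· ∈ A), ∑ y ∈ Aᶜ, (if c x y = i then (1 : ℝ) else 0) := by
      simp [edgeSum]
    rw [← h4]
    have h5 : γ * (γ * Fintype.card U) * #Aᶜ ≤ γ * #A * #Aᶜ := by gcongr
    nlinarith

/-- Explored vertices may lie outside the sample `T`, but exploration only steps through members of
`T`; hence connectivity is claimed only for reached vertices that lie in `T`. -/
theorem reach_connected {c : U → U → Fin 3} {i : Fin 3} {T : Set U} {u : U} (k : ℕ) :
    ∀ (A : Finset U) (f : Fin k → U), (∀ l, f l ∈ T) →
      (∀ a ∈ A, a ∈ T → ReflTransGen (ColorAdj c T i) u a) →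
      ∀ a ∈ reach c i k A f, a ∈ T → ReflTransGen (ColorAdj c T i) u a := by
  induction k with
  | zero => intro A f _ h; exact h
  | succ k ih =>
    intro A f hf h
    refine ih _ _ (fun l => hf l.succ) ?_
    split_ifs with h0
    · intro a ha haT
      rcases mem_union.1 ha with ha | ha
      · exact h a ha haT
      · exact (h _ h0 (hf 0)).tail ⟨hf 0, haT, (mem_filter.1 ha).2⟩
    · exact h

/-- The sample `f` avoids all events that could disconnect a color on its range. -/
def GoodSample (c : U → U → Fin 3) {k : ℕ} (f : Fin (k + 2) → U) : Prop :=
  f 1 ≠ f 0 ∧ ∀ (i : Fin 3) (j : Fin (k + 1)), Fin.tail f j ∈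
    reach c i k (insert (f 0) (univ.filter fun y => c (f 0) y = i)) (j.removeNth (Fin.tail f))

theorem GoodSample.exists_rainbowTriple {c : U → U → Fin 3} (hc : ∀ x y, c x y = c y x) {k : ℕ}
    {f : Fin (k + 2) → U} (hf : GoodSample c f) :
    ∃ a b d, RainbowTriple c (f a) (f b) (f d) := by
  have hT : ∀ l, f l ∈ ((univ.image f : Finset U) : Set U) := by intro l; simp
  have hconn0 : ∀ i l, ReflTransGen (ColorAdj c (univ.image f : Finset U) i) (f 0) (f l) := by
    intro i l
    refine Fin.cases .refl (fun j => ?_) l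
    refine reach_connected k _ _ (fun l => hT _) ?_ _ (hf.2 i j) (hT _)
    intro a ha haT
    rcases mem_insert.1 ha with rfl | ha
    · exact .refl
    · exact .single ⟨hT 0, haT, (mem_filter.1 ha).2⟩
  have hsymm : ∀ i, Std.Symm (ColorAdj c ((univ.image f : Finset U) : Set U) i) := fun i =>
    ⟨fun a b h => ⟨h.2.1, h.1, by rw [hc]; exact h.2.2⟩⟩
  obtain ⟨x, hx, y, hy, z, hz, h⟩ := exists_rainbowTriple_of_connected hc (univ.image f)
    ⟨f 1, hT 1, f 0, hT 0, hf.1⟩ (by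
      intro i x hx y hy
      obtain ⟨a, -, rfl⟩ := mem_image.1 hx
      obtain ⟨b, -, rfl⟩ := mem_image.1 hy
      have := hsymm i
      exact (Std.Symm.symm _ _ (hconn0 i a)).trans (hconn0 i b))
  obtain ⟨a, -, rfl⟩ := mem_image.1 hx
  obtain ⟨b, -, rfl⟩ := mem_image.1 hy
  obtain ⟨d, -, rfl⟩ := mem_image.1 hz
  exact ⟨a, b, d, h⟩

-- Removing position `j` from the explored list makes the vertex at `j` independent of the reached
-- set, so averaging over it measures the complement of that set.
open Classical in
theorem card_disconnected_le {c : U → U → Fin 3} {i : Fin 3} {γ : ℝ} (hγ0 : 0 ≤ γ)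
    (hγ1 : γ ≤ 1) (hcut : ∀ A : Finset U, γ * #A * #Aᶜ ≤ edgeSum c i A Aᶜ) {k : ℕ}
    (j : Fin (k + 1)) :
    (#(univ.filter fun f : Fin (k + 2) → U => Fin.tail f j ∉
      reach c i k (insert (f 0) (univ.filter fun y => c (f 0) y = i))
        (j.removeNth (Fin.tail f))) : ℝ) ≤
      Fintype.card U ^ (k + 2) * (1 - γ ^ 2) ^ k := by
  rw [← sum_boole, sum_fin_succ_fun]
  simp_rw [Fin.cons_zero, Fin.tail_cons, sum_fin_insertNth j, Fin.insertNth_apply_same,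
    Fin.removeNth_insertNth]
  have h : ∀ u : U, ∑ v : U, ∑ g : Fin k → U,
      (if v ∉ reach c i k (insert u (univ.filter fun y => c u y = i)) g then (1 : ℝ) else 0) ≤
      (Fintype.card U * (1 - γ ^ 2)) ^ k * Fintype.card U := by
    intro u
    rw [sum_comm]
    -- The cut around `{u}` gives `γ (m - 1)` neighbors among `m` vertices; counting `u` itself
    -- makes up the missing `γ ≤ 1`.
    have hA : γ * Fintype.card U ≤ #(insert u (univ.filter fun y => c u y = i)) := by
      have h1 := hcut {u}
      rw [card_compl, edgeSum, sum_singleton, card_singleton, sum_boole,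
        Nat.cast_sub (Fintype.card_pos_iff.2 ⟨u⟩)] at h1
      have h2 : #(filter (fun y => c u y = i) {u}ᶜ) + 1 ≤
          #(insert u (univ.filter fun y => c u y = i)) := by
        rw [← card_insert_of_notMem (a := u) (by simp)]
        refine card_le_card (insert_subset_insert _ (filter_subset_filter _ (subset_univ _)))
      have h3 : (#(filter (fun y => c u y = i) {u}ᶜ) : ℝ) + 1 ≤
          #(insert u (univ.filter fun y => c u y = i)) := by exact_mod_cast h2
      push_cast at h1
      nlinarith
    have h2 := sum_card_compl_reach_le hγ0 hγ1 hcut k _ hA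
    have h3 : ∀ g : Fin k → U, ∑ v : U, (if v ∉ reach c i k (insert u
        (univ.filter fun y => c u y = i)) g then (1 : ℝ) else 0) =
        #(reach c i k (insert u (univ.filter fun y => c u y = i)) g)ᶜ := by
      intro g
      rw [sum_boole]
      congr 2
      ext v
      simp
    simp_rw [h3]
    refine h2.trans (mul_le_mul_of_nonneg_left ?_ (pow_nonneg ?_ k))
    · exact_mod_cast card_le_univ _
    · exact mul_nonneg (Nat.cast_nonneg _) (by nlinarith)
  refine (sum_le_sum fun u _ => h u).trans (le_of_eq ?_)
  rw [sum_const, card_univ, nsmul_eq_mul, mul_pow]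
  ring

/-- If every cut has density at least `γ` in all three colors, then a positive proportion of the
triples is rainbow. -/
theorem card_pow_three_le_of_cut {c : U → U → Fin 3} (hc : ∀ x y, c x y = c y x) {γ : ℝ}
    (hγ0 : 0 ≤ γ) (hγ1 : γ ≤ 1)
    (hcut : ∀ i, ∀ A : Finset U, γ * #A * #Aᶜ ≤ edgeSum c i A Aᶜ) {k : ℕ}
    (hk : 3 * (k + 1) * (1 - γ ^ 2) ^ k ≤ 1 / 4) (hU : 4 ≤ Fintype.card U) :
    (Fintype.card U : ℝ) ^ 3 ≤ 2 * (k + 2) ^ 3 * rainbowSum c univ := by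
  classical
  set m : ℝ := (Fintype.card U : ℝ) with hm
  have hm4 : (4 : ℝ) ≤ m := by rw [hm]; exact_mod_cast hU
  have hRT : rainbowSum c univ =
      #(univ.filter fun p : U × U × U => RainbowTriple c p.1 p.2.1 p.2.2) := by
    rw [rainbowSum, ← sum_boole, Fintype.sum_prod_type]
    refine sum_congr rfl fun x _ => ?_
    rw [Fintype.sum_prod_type]
  set R : ℝ := rainbowSum c univ with hR
  have hR0 : 0 ≤ R := by rw [hRT]; positivity
  have htrip : ∀ a b d : Fin (k + 2),
      (#(univ.filter fun f : Fin (k + 2) → U => RainbowTriple c (f a) (f b) (f d)) : ℝ) * m ^ 3 ≤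
        R * m ^ (k + 2) := by
    intro a b d
    by_cases h : a ≠ b ∧ a ≠ d ∧ b ≠ d
    · rw [hRT]
      exact card_filter_triple_mul_le _ h.1 h.2.1 h.2.2
    · have : (univ.filter fun f : Fin (k + 2) → U => RainbowTriple c (f a) (f b) (f d)) = ∅ := by
        refine filter_false_of_mem fun f _ hf => h ⟨?_, ?_, ?_⟩ <;> rintro rfl
        · exact hf.2.1 rfl
        · exact hf.1 (hc _ _)
        · exact hf.2.2 rfl
      rw [this]
      simp only [card_empty, CharP.cast_eq_zero, zero_mul]
      positivity
  have hconst : (#(univ.filter fun f : Fin (k + 2) → U => f 1 = f 0) : ℝ) ≤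
      m ^ (k + 2) * (1 / 4) := by
    rw [← sum_boole, sum_fin_succ_fun]
    have h1 : ∀ x : U, ∑ g : Fin (k + 1) → U,
        (if (Fin.cons x g : Fin (k + 2) → U) 1 = (Fin.cons x g : Fin (k + 2) → U) 0
          then (1 : ℝ) else 0) = m ^ k := by
      intro x
      rw [sum_fin_succ_fun]
      have h2 : ∀ (y : U) (g : Fin k → U),
          (Fin.cons x (Fin.cons y g : Fin (k + 1) → U) : Fin (k + 2) → U) 1 = y :=
        fun y g => rfl
      simp only [h2, Fin.cons_zero]
      simp [hm]
    rw [sum_congr rfl fun x _ => h1 x, sum_const, card_univ, nsmul_eq_mul, ← hm]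
    have : 0 ≤ m ^ k * m := by positivity
    calc m * m ^ k = m ^ k * m * 1 := by ring
      _ ≤ m ^ k * m * (m * (1 / 4)) := by gcongr; linarith
      _ = _ := by ring
  have hbad : ∑ i : Fin 3, ∑ j : Fin (k + 1),
      (#(univ.filter fun f : Fin (k + 2) → U => Fin.tail f j ∉
        reach c i k (insert (f 0) (univ.filter fun y => c (f 0) y = i))
          (j.removeNth (Fin.tail f))) : ℝ) ≤ m ^ (k + 2) * (1 / 4) := by
    refine (sum_le_sum fun i _ => sum_le_sum fun j _ =>
      card_disconnected_le hγ0 hγ1 (hcut i) j).trans ?_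
    rw [sum_const, sum_const, card_univ, card_univ, Fintype.card_fin, Fintype.card_fin,
      nsmul_eq_mul, nsmul_eq_mul, ← hm]
    calc _ = m ^ (k + 2) * (3 * (k + 1) * (1 - γ ^ 2) ^ k) := by push_cast; ring
      _ ≤ _ := by gcongr
  -- Every sample starts with a repeated vertex, fails to reach some vertex in some color, or
  -- contains a rainbow triple. The first two kinds take up at most a quarter each, so at least half
  -- of the samples are of the third kind.
  have hcover : m ^ (k + 2) ≤
      (#(univ.filter fun f : Fin (k + 2) → U => f 1 = f 0) : ℝ) +
      ∑ i : Fin 3, ∑ j : Fin (k + 1),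
        (#(univ.filter fun f : Fin (k + 2) → U => Fin.tail f j ∉
          reach c i k (insert (f 0) (univ.filter fun y => c (f 0) y = i))
            (j.removeNth (Fin.tail f))) : ℝ) +
      ∑ a : Fin (k + 2), ∑ b : Fin (k + 2), ∑ d : Fin (k + 2),
        (#(univ.filter fun f : Fin (k + 2) → U => RainbowTriple c (f a) (f b) (f d)) : ℝ) := by
    have h1 : (univ : Finset (Fin (k + 2) → U)) ⊆
        (univ.filter fun f : Fin (k + 2) → U => f 1 = f 0) ∪
        (univ.biUnion fun i : Fin 3 => univ.biUnion fun j : Fin (k + 1) =>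
          univ.filter fun f : Fin (k + 2) → U => Fin.tail f j ∉
            reach c i k (insert (f 0) (univ.filter fun y => c (f 0) y = i))
              (j.removeNth (Fin.tail f))) ∪
        (univ.biUnion fun a : Fin (k + 2) => univ.biUnion fun b : Fin (k + 2) =>
          univ.biUnion fun d : Fin (k + 2) =>
          univ.filter fun f : Fin (k + 2) → U => RainbowTriple c (f a) (f b) (f d)) := by
      intro f _
      simp only [mem_union, mem_biUnion, mem_filter, mem_univ, true_and]
      by_cases hg : GoodSample c f
      · exact Or.inr (hg.exists_rainbowTriple hc)
      · left
        rw [GoodSample, not_and_or] at hg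
        push Not at hg
        exact hg
    have h2 := (card_le_card h1).trans ((card_union_le _ _).trans
      (add_le_add ((card_union_le _ _).trans (add_le_add le_rfl
        (card_biUnion_le.trans (sum_le_sum fun i _ => card_biUnion_le))))
        (card_biUnion_le.trans (sum_le_sum fun a _ => card_biUnion_le.trans
          (sum_le_sum fun b _ => card_biUnion_le)))))
    rw [card_univ, Fintype.card_fun, Fintype.card_fin] at h2
    rw [hm]
    exact_mod_cast h2
  have hmpos : 0 < m ^ (k + 2) := by positivity
  have hgood : m ^ (k + 2) * (1 / 2) * m ^ 3 ≤ (k + 2) ^ 3 * (R * m ^ (k + 2)) := by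
    calc m ^ (k + 2) * (1 / 2) * m ^ 3 ≤ (∑ a : Fin (k + 2), ∑ b : Fin (k + 2), ∑ d : Fin (k + 2),
        (#(univ.filter fun f : Fin (k + 2) → U => RainbowTriple c (f a) (f b) (f d)) : ℝ)) *
          m ^ 3 := by
          gcongr
          linarith
      _ = ∑ a : Fin (k + 2), ∑ b : Fin (k + 2), ∑ d : Fin (k + 2),
        (#(univ.filter fun f : Fin (k + 2) → U => RainbowTriple c (f a) (f b) (f d)) : ℝ) *
          m ^ 3 := by simp_rw [sum_mul]
      _ ≤ ∑ a : Fin (k + 2), ∑ b : Fin (k + 2), ∑ d : Fin (k + 2), R * m ^ (k + 2) :=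
        sum_le_sum fun a _ => sum_le_sum fun b _ => sum_le_sum fun d _ => htrip a b d
      _ = _ := by
        simp only [sum_const, card_univ, Fintype.card_fin, nsmul_eq_mul]
        push_cast
        ring
  have h6 : m ^ (k + 2) * m ^ 3 ≤ m ^ (k + 2) * (2 * (k + 2) ^ 3 * R) := by linarith
  exact le_of_mul_le_mul_left h6 hmpos

end Sampling

theorem card_pow_three_le_of_cut_finset {V : Type*} [DecidableEq V] {c : V → V → Fin 3}
    (hc : ∀ x y, c x y = c y x) {γ : ℝ} (hγ0 : 0 ≤ γ) (hγ1 : γ ≤ 1) {W : Finset V}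
    (hcut : ∀ i, ∀ A B : Finset V, Disjoint A B → A ∪ B = W → γ * #A * #B ≤ edgeSum c i A B)
    {k : ℕ} (hk : 3 * (k + 1) * (1 - γ ^ 2) ^ k ≤ 1 / 4) (hW : 4 ≤ #W) :
    (#W : ℝ) ^ 3 ≤ 2 * (k + 2) ^ 3 * rainbowSum c W := by
  have h := card_pow_three_le_of_cut (U := W) (c := fun x y => c x y) (fun x y => hc x y)
    hγ0 hγ1 (by
      intro i A
      have h1 := hcut i (A.map (Function.Embedding.subtype _)) (Aᶜ.map (Function.Embedding.subtype _))
        ((disjoint_map _).2 disjoint_compl_right)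
        (by rw [← map_union, union_compl, univ_eq_attach, attach_map_val])
      rw [card_map, card_map] at h1
      refine h1.trans (le_of_eq ?_)
      simp only [edgeSum, sum_map, Function.Embedding.subtype_apply]
      congr!) hk (by simpa using hW)
  rw [Fintype.card_coe] at h
  refine h.trans (le_of_eq ?_)
  congr 1
  simp only [rainbowSum, univ_eq_attach]
  rw [← sum_attach W]
  refine sum_congr rfl fun x _ => ?_
  rw [← sum_attach W]
  refine sum_congr rfl fun y _ => ?_
  rw [← sum_attach W]
  rfl

/-! ### Auxiliary identities; extremal partitions with respect to one color. -/

theorem color_cases {i j k : Fin 3} (hji : j ≠ i) (hki : k ≠ i) (hjk : j ≠ k) (d : Fin 3) :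
    d = i ∨ d = j ∨ d = k := by
  revert i j k d
  decide

open Classical in
theorem sum_sum_indicator {V : Type*} {W A B : Finset V} (hA : A ⊆ W) (hB : B ⊆ W) (p : V → V → Prop)
    [∀ x y, Decidable (p x y)] :
    ∑ x ∈ W, ∑ y ∈ W, (if x ∈ A ∧ y ∈ B ∧ p x y then (1 : ℝ) else 0) =
      ∑ x ∈ A, ∑ y ∈ B, if p x y then 1 else 0 := by
  simp_rw [ite_and]
  have h1 : ∀ x, ∑ y ∈ W, (if x ∈ A then (if y ∈ B then (if p x y then (1 : ℝ) else 0) else 0)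
      else 0) = if x ∈ A then ∑ y ∈ B, (if p x y then (1 : ℝ) else 0) else 0 := by
    intro x
    split_ifs
    · rw [← sum_filter, filter_mem_eq_inter, inter_eq_right.2 hB]
    · simp
  simp_rw [h1]
  rw [← sum_filter, filter_mem_eq_inter, inter_eq_right.2 hA]

theorem edgeSum_comm {V : Type*} {c : V → V → Fin 3} (hc : ∀ x y, c x y = c y x) (i : Fin 3)
    (A B : Finset V) : edgeSum c i A B = edgeSum c i B A := by
  rw [edgeSum, edgeSum, sum_comm]
  simp_rw [hc]

section Extremal

variable {V : Type*} [Fintype V]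

theorem finite_setoid : Finite (Setoid V) :=
  Finite.of_injective (fun (r : Setoid V) (x y : V) => r x y) fun r s h =>
    Setoid.ext fun x y => by rw [show r x y = s x y from congrFun (congrFun h x) y]

open Classical in
/-- The number of ordered pairs of color `i` in `W` that avoid `Z` and are separated by `r`. -/
noncomputable def crossSum (c : V → V → Fin 3) (i : Fin 3) (W Z : Finset V) (r : Setoid V) : ℝ :=
  ∑ x ∈ W, ∑ y ∈ W, if x ∉ Z ∧ y ∉ Z ∧ ¬ r x y ∧ c x y = i then 1 else 0

open Classical in
/-- The number of ordered pairs in `W` that avoid `Z` and are not separated by `r`. -/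
noncomputable def sameSum (W Z : Finset V) (r : Setoid V) : ℝ :=
  ∑ x ∈ W, ∑ y ∈ W, if x ∉ Z ∧ y ∉ Z ∧ r x y then 1 else 0

open Classical in
/-- An extremal partition (the classes of `r` outside of `Z`): there are few separated edges of
color `i` and few deleted vertices compared to the number of separated pairs, and no class can be
separated cheaply, even if vertices may be deleted. -/
theorem exists_extremal_partition {c : V → V → Fin 3} (hc : ∀ x y, c x y = c y x) (i : Fin 3)
    (W : Finset V) {K θ : ℝ} (hK : 0 ≤ K) (hθ : 0 ≤ θ) :
    ∃ (Z : Finset V) (r : Setoid V),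
      crossSum c i W Z r + 2 * K * #Z + θ * sameSum W Z r ≤ θ * (#W : ℝ) ^ 2 ∧
      ∀ x₀, ∀ A B D : Finset V, Disjoint A B → Disjoint A D → Disjoint B D →
        A ∪ B ∪ D = W.filter (fun y => y ∉ Z ∧ r x₀ y) →
        θ * #A * #B ≤ edgeSum c i A B + K * #D := by
  have := finite_setoid (V := V)
  obtain ⟨⟨Z, r⟩, hmin⟩ := Finite.exists_min (fun p : Finset V × Setoid V =>
    crossSum c i W p.1 p.2 + 2 * K * #p.1 + θ * sameSum W p.1 p.2)
  refine ⟨Z, r, ?_, ?_⟩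
  -- The trivial partition has nothing deleted or separated, so its weight is exactly the right-hand
  -- side.
  · refine (hmin (∅, ⊤)).trans (le_of_eq ?_)
    have h0 : ∀ x y : V, (⊤ : Setoid V) x y := fun _ _ => trivial
    have h1 : crossSum c i W ∅ ⊤ = 0 := by simp [crossSum, h0]
    have h2 : sameSum W ∅ ⊤ = (#W : ℝ) ^ 2 := by simp [sameSum, h0, sq]
    simp [h1, h2]
  · intro x₀ A B D hAB hAD hBD hP
    have hmem : ∀ y, (y ∈ A ∨ y ∈ B ∨ y ∈ D) ↔ (y ∈ W ∧ y ∉ Z ∧ r x₀ y) := by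
      intro y
      have := Finset.ext_iff.1 hP y
      simpa [or_assoc] using this
    have hAW : A ⊆ W := fun y hy => ((hmem y).1 (Or.inl hy)).1
    have hBW : B ⊆ W := fun y hy => ((hmem y).1 (Or.inr (Or.inl hy))).1
    have hAB' : ∀ y, y ∈ A → y ∉ B := fun y h h' => disjoint_left.1 hAB h h'
    set r' : Setoid V := r ⊓ Setoid.ker (fun y => y ∈ A) with hr'
    have hr'iff : ∀ x y, r' x y ↔ r x y ∧ (x ∈ A ↔ y ∈ A) := by
      intro x y
      constructor
      · rintro ⟨h1, h2⟩
        exact ⟨h1, eq_iff_iff.1 h2⟩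
      · rintro ⟨h1, h2⟩
        exact ⟨h1, eq_iff_iff.2 h2⟩
    -- The competitor deletes `D` and separates `A` from `B`. Ordered pairs count each change twice,
    -- which is why the deletion weight is `2 * K`.
    have h := hmin (Z ∪ D, r')
    simp only at h
    have hcross : crossSum c i W (Z ∪ D) r' ≤
        crossSum c i W Z r + 2 * edgeSum c i A B := by
      have e1 : edgeSum c i A B = ∑ x ∈ W, ∑ y ∈ W,
          (if x ∈ A ∧ y ∈ B ∧ c x y = i then (1 : ℝ) else 0) := by
        rw [sum_sum_indicator hAW hBW, edgeSum]
      have e2 : edgeSum c i A B = ∑ x ∈ W, ∑ y ∈ W,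
          (if x ∈ B ∧ y ∈ A ∧ c x y = i then (1 : ℝ) else 0) := by
        rw [sum_sum_indicator hBW hAW, edgeSum_comm hc, edgeSum]
      rw [two_mul]
      nth_rewrite 1 [e1]
      rw [e2, crossSum, crossSum]
      simp_rw [← sum_add_distrib]
      refine sum_le_sum fun x hx => sum_le_sum fun y hy => ?_
      by_cases hg : x ∉ Z ∪ D ∧ y ∉ Z ∪ D ∧ ¬ r' x y ∧ c x y = i
      · rw [if_pos hg]
        obtain ⟨h1, h2, h3, h4⟩ := hg
        rw [mem_union, not_or] at h1 h2
        rw [hr'iff] at h3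
        by_cases hr : r x y
        · have h5 : ¬ (x ∈ A ↔ y ∈ A) := fun h => h3 ⟨hr, h⟩
          by_cases hxA : x ∈ A
          · have hyA : y ∉ A := fun h => h5 ⟨fun _ => h, fun _ => hxA⟩
            have h6 := (hmem x).1 (Or.inl hxA)
            have h7 := (hmem y).2 ⟨hy, h2.1, r.trans h6.2.2 hr⟩
            have hyB : y ∈ B := (h7.resolve_left hyA).resolve_right h2.2
            rw [if_pos (show x ∈ A ∧ y ∈ B ∧ c x y = i from ⟨hxA, hyB, h4⟩)]
            split_ifs <;> norm_num
          · have hyA : y ∈ A := by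
              by_contra h
              exact h5 ⟨fun h' => absurd h' hxA, fun h' => absurd h' h⟩
            have h6 := (hmem y).1 (Or.inl hyA)
            have h7 := (hmem x).2 ⟨hx, h1.1, r.trans h6.2.2 (r.symm hr)⟩
            have hxB : x ∈ B := (h7.resolve_left hxA).resolve_right h1.2
            rw [if_pos (show x ∈ B ∧ y ∈ A ∧ c x y = i from ⟨hxB, hyA, h4⟩)]
            split_ifs <;> norm_num
        · rw [if_pos (show x ∉ Z ∧ y ∉ Z ∧ ¬ r x y ∧ c x y = i from ⟨h1.1, h2.1, hr, h4⟩)]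
          split_ifs <;> norm_num
      · rw [if_neg hg]
        split_ifs <;> norm_num
    have hsame : sameSum W (Z ∪ D) r' + 2 * (#A * #B) ≤ sameSum W Z r := by
      have e1 : (#A * #B : ℝ) = ∑ x ∈ W, ∑ y ∈ W,
          (if x ∈ A ∧ y ∈ B ∧ True then (1 : ℝ) else 0) := by
        rw [sum_sum_indicator hAW hBW (fun _ _ => True)]; simp
      have e2 : (#A * #B : ℝ) = ∑ x ∈ W, ∑ y ∈ W,
          (if x ∈ B ∧ y ∈ A ∧ True then (1 : ℝ) else 0) := by
        rw [sum_sum_indicator hBW hAW (fun _ _ => True)]; simp [mul_comm]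
      rw [two_mul]
      nth_rewrite 1 [e1]
      rw [e2, sameSum, sameSum]
      simp_rw [← sum_add_distrib]
      refine sum_le_sum fun x hx => sum_le_sum fun y hy => ?_
      by_cases h1 : x ∈ A ∧ y ∈ B ∧ True
      · have hx' := (hmem x).1 (Or.inl h1.1)
        have hy' := (hmem y).1 (Or.inr (Or.inl h1.2.1))
        have h2 : ¬ (x ∈ B ∧ y ∈ A ∧ True) := fun h => hAB' _ h1.1 h.1
        have h3 : ¬ (x ∉ Z ∪ D ∧ y ∉ Z ∪ D ∧ r' x y) := by
          rintro ⟨-, -, h⟩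
          exact hAB' y (((hr'iff x y).1 h).2.1 h1.1) h1.2.1
        rw [if_pos h1, if_neg h2, if_neg h3,
          if_pos ⟨hx'.2.1, hy'.2.1, r.trans (r.symm hx'.2.2) hy'.2.2⟩]
        norm_num
      · rw [if_neg h1]
        by_cases h2 : x ∈ B ∧ y ∈ A ∧ True
        · have hy' := (hmem y).1 (Or.inl h2.2.1)
          have hx' := (hmem x).1 (Or.inr (Or.inl h2.1))
          have h3 : ¬ (x ∉ Z ∪ D ∧ y ∉ Z ∪ D ∧ r' x y) := by
            rintro ⟨-, -, h⟩
            exact hAB' x (((hr'iff x y).1 h).2.2 h2.2.1) h2.1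
          rw [if_pos h2, if_neg h3,
            if_pos ⟨hx'.2.1, hy'.2.1, r.trans (r.symm hx'.2.2) hy'.2.2⟩]
          norm_num
        · rw [if_neg h2]
          by_cases h3 : x ∉ Z ∪ D ∧ y ∉ Z ∪ D ∧ r' x y
          · rw [if_pos h3, if_pos ⟨fun h => h3.1 (mem_union_left _ h),
              fun h => h3.2.1 (mem_union_left _ h), ((hr'iff x y).1 h3.2.2).1⟩]
            norm_num
          · rw [if_neg h3]
            split_ifs <;> norm_num
    have hcard : (#(Z ∪ D) : ℝ) ≤ #Z + #D := by exact_mod_cast card_union_le _ _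
    have h8 : 2 * K * (#(Z ∪ D) : ℝ) ≤ 2 * K * (#Z + #D) := by gcongr
    have h9 := mul_le_mul_of_nonneg_left hsame hθ
    nlinarith

end Extremal

/-! ### Near-monochromatic vertices and pairs of sets. -/

section Pairs

variable {V : Type*}

/-- The number of vertices of `Y` joined to `x` in color `i`. -/
noncomputable def colorDeg (c : V → V → Fin 3) (i : Fin 3) (x : V) (Y : Finset V) : ℝ :=
  ∑ y ∈ Y, if c x y = i then 1 else 0

theorem colorDeg_nonneg (c : V → V → Fin 3) (i : Fin 3) (x : V) (Y : Finset V) :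
    0 ≤ colorDeg c i x Y := sum_nonneg fun _ _ => by split_ifs <;> norm_num

theorem edgeSum_nonneg (c : V → V → Fin 3) (i : Fin 3) (X Y : Finset V) :
    0 ≤ edgeSum c i X Y := sum_nonneg fun x _ => colorDeg_nonneg c i x Y

theorem colorDeg_eq_card (c : V → V → Fin 3) (i : Fin 3) (x : V) (Y : Finset V) :
    colorDeg c i x Y = #(Y.filter fun y => c x y = i) := by
  rw [colorDeg, sum_boole]

theorem colorDeg_add {i j k : Fin 3} (hji : j ≠ i) (hki : k ≠ i) (hjk : j ≠ k)
    (c : V → V → Fin 3) (x : V) (Y : Finset V) :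
    colorDeg c i x Y + colorDeg c j x Y + colorDeg c k x Y = #Y := by
  rw [colorDeg, colorDeg, colorDeg, ← sum_add_distrib, ← sum_add_distrib, card_eq_sum_ones,
    Nat.cast_sum]
  refine sum_congr rfl fun y _ => ?_
  have : c x y = i ∨ c x y = j ∨ c x y = k :=
        color_cases hji hki hjk _
  rcases this with h | h | h <;> simp [h, hji, hki, hjk, hji.symm, hki.symm, hjk.symm]

/-- If almost all rows and almost all columns of a pair are nearly monochromatic, then so is the
pair. -/
theorem min_edgeSum_le {c : V → V → Fin 3} (hc : ∀ x y, c x y = c y x) {i j k : Fin 3}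
    (hji : j ≠ i) (hki : k ≠ i) (hjk : j ≠ k) (X Y : Finset V) :
    min (edgeSum c j X Y) (edgeSum c k X Y) ≤
      4 * (∑ x ∈ X, min (colorDeg c j x Y) (colorDeg c k x Y) +
        ∑ y ∈ Y, min (colorDeg c j y X) (colorDeg c k y X) + edgeSum c i X Y) := by
  have hmin : ∀ (x : V) (Y : Finset V), colorDeg c j x Y * colorDeg c k x Y ≤
      min (colorDeg c j x Y) (colorDeg c k x Y) * #Y := by
    intro x Y
    have h1 := colorDeg_add hji hki hjk c x Y
    have h2 := colorDeg_nonneg c i x Y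
    have h3 := colorDeg_nonneg c j x Y
    have h4 := colorDeg_nonneg c k x Y
    rw [← min_mul_max]
    refine mul_le_mul_of_nonneg_left (max_le ?_ ?_) (le_min h3 h4) <;> linarith
  have hprod : edgeSum c j X Y * edgeSum c k X Y ≤ #X * #Y *
      (∑ x ∈ X, min (colorDeg c j x Y) (colorDeg c k x Y) +
        ∑ y ∈ Y, min (colorDeg c j y X) (colorDeg c k y X) + edgeSum c i X Y) := by
    have e0 : edgeSum c j X Y * edgeSum c k X Y = ∑ x ∈ X, ∑ x' ∈ X, ∑ y ∈ Y, ∑ y' ∈ Y,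
        (if c x y = j then (1 : ℝ) else 0) * (if c x' y' = k then 1 else 0) := by
      simp_rw [edgeSum, sum_mul_sum]
    -- Given `x y` of color `j` and `x' y'` of color `k`, inspect `x y'`: color `k` makes the row of
    -- `x` mixed, color `j` makes the column of `y'` mixed, and the rest is color `i`.
    have hpt : ∀ x x' y y' : V,
        (if c x y = j then (1 : ℝ) else 0) * (if c x' y' = k then 1 else 0) ≤
        (if c x y = j then (1 : ℝ) else 0) * (if c x y' = k then 1 else 0) +
        (if c y' x = j then (1 : ℝ) else 0) * (if c y' x' = k then 1 else 0) +
        (if c x y' = i then (1 : ℝ) else 0) := by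
      intro x x' y y'
      rw [hc y' x, hc y' x']
      have : c x y' = i ∨ c x y' = j ∨ c x y' = k :=
        color_cases hji hki hjk _
      rcases this with h | h | h <;> simp only [h, if_true, mul_one, one_mul] <;>
        split_ifs <;> norm_num
    have e1 : ∑ x ∈ X, ∑ x' ∈ X, ∑ y ∈ Y, ∑ y' ∈ Y,
        (if c x y = j then (1 : ℝ) else 0) * (if c x y' = k then 1 else 0) =
        #X * ∑ x ∈ X, colorDeg c j x Y * colorDeg c k x Y := by
      simp_rw [sum_const, nsmul_eq_mul, ← mul_sum, colorDeg, sum_mul]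
    have e2 : ∑ x ∈ X, ∑ x' ∈ X, ∑ y ∈ Y, ∑ y' ∈ Y,
        (if c y' x = j then (1 : ℝ) else 0) * (if c y' x' = k then 1 else 0) =
        #Y * ∑ y ∈ Y, colorDeg c j y X * colorDeg c k y X := by
      simp_rw [sum_const, nsmul_eq_mul, ← mul_sum, colorDeg, sum_mul_sum]
      congr 1
      rw [sum_comm]
      rw [sum_comm]
      rw [sum_congr rfl fun x _ => sum_comm]
      rw [sum_comm]
    have e3 : ∑ x ∈ X, ∑ _x' ∈ X, ∑ _y ∈ Y, ∑ y' ∈ Y, (if c x y' = i then (1 : ℝ) else 0) =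
        #X * #Y * edgeSum c i X Y := by
      simp_rw [sum_const, nsmul_eq_mul, ← mul_sum, edgeSum, mul_assoc]
    rw [e0]
    refine (sum_le_sum fun x _ => sum_le_sum fun x' _ => sum_le_sum fun y _ =>
      sum_le_sum fun y' _ => hpt x x' y y').trans ?_
    simp_rw [sum_add_distrib]
    rw [e1, e2, e3]
    have f1 : ∑ x ∈ X, colorDeg c j x Y * colorDeg c k x Y ≤
        (∑ x ∈ X, min (colorDeg c j x Y) (colorDeg c k x Y)) * #Y := by
      rw [sum_mul]
      exact sum_le_sum fun x _ => hmin x Y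
    have f2 : ∑ y ∈ Y, colorDeg c j y X * colorDeg c k y X ≤
        (∑ y ∈ Y, min (colorDeg c j y X) (colorDeg c k y X)) * #X := by
      rw [sum_mul]
      exact sum_le_sum fun y _ => hmin y X
    have g1 := mul_le_mul_of_nonneg_left f1 (Nat.cast_nonneg (α := ℝ) #X)
    have g2 := mul_le_mul_of_nonneg_left f2 (Nat.cast_nonneg (α := ℝ) #Y)
    linarith
  have htot : edgeSum c i X Y + edgeSum c j X Y + edgeSum c k X Y = #X * #Y := by
    have : ∀ l, edgeSum c l X Y = ∑ x ∈ X, colorDeg c l x Y := fun l => rfl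
    rw [this, this, this, ← sum_add_distrib, ← sum_add_distrib,
      sum_congr rfl fun x _ => colorDeg_add hji hki hjk c x Y, sum_const, nsmul_eq_mul]
  set E := ∑ x ∈ X, min (colorDeg c j x Y) (colorDeg c k x Y) +
        ∑ y ∈ Y, min (colorDeg c j y X) (colorDeg c k y X) with hE
  have hE0 : 0 ≤ E := add_nonneg
    (sum_nonneg fun x _ => le_min (colorDeg_nonneg _ _ _ _) (colorDeg_nonneg _ _ _ _))
    (sum_nonneg fun x _ => le_min (colorDeg_nonneg _ _ _ _) (colorDeg_nonneg _ _ _ _))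
  have hi := edgeSum_nonneg c i X Y
  have hj := edgeSum_nonneg c j X Y
  have hk := edgeSum_nonneg c k X Y
  set N : ℝ := #X * #Y with hN
  -- If color `i` fills less than half of the pairs, one of `j`, `k` has at least a quarter of them;
  -- dividing the product bound by it gives the factor `4`.
  by_cases hbig : N ≤ 2 * edgeSum c i X Y
  · refine (min_le_left _ _).trans ?_
    linarith
  · push Not at hbig
    have hN0 : 0 < N := by linarith
    rw [← min_mul_max] at hprod
    have hmax : N / 4 ≤ max (edgeSum c j X Y) (edgeSum c k X Y) := by
      have h1 := le_max_left (edgeSum c j X Y) (edgeSum c k X Y)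
      have h2 := le_max_right (edgeSum c j X Y) (edgeSum c k X Y)
      linarith
    have h3 := mul_le_mul_of_nonneg_left hmax (le_min hj hk)
    have h4 : N * min (edgeSum c j X Y) (edgeSum c k X Y) ≤ N * (4 * (E + edgeSum c i X Y)) := by
      linarith
    exact le_of_mul_le_mul_left h4 hN0

open Classical in
/-- A vertex that sends few edges of color `i` to an inseparable set `P`, and that is in few rainbow
triples with `P`, is nearly monochromatic to `P`. -/
theorem min_colorDeg_le {c : V → V → Fin 3} {i j k : Fin 3}
    (hji : j ≠ i) (hki : k ≠ i) (hjk : j ≠ k) {P : Finset V} {K θ : ℝ} (hθ : 0 ≤ θ)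
    (hP : ∀ A B D : Finset V, Disjoint A B → Disjoint A D → Disjoint B D → A ∪ B ∪ D = P →
      θ * #A * #B ≤ edgeSum c i A B + K * #D) (x : V) :
    θ * min (colorDeg c j x P) (colorDeg c k x P) * #P ≤
      2 * (∑ y ∈ P, ∑ z ∈ P, if RainbowTriple c x y z then 1 else 0) +
        (2 * K + θ * #P) * colorDeg c i x P := by
  have hdis : ∀ a b : Fin 3, a ≠ b →
      Disjoint (P.filter fun y => c x y = a) (P.filter fun y => c x y = b) := by
    intro a b hab
    refine disjoint_filter.2 fun y _ h1 h2 => hab (h1.symm.trans h2)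
  -- Split `P` by the color seen from `x`, deleting the `i`-neighbors: each remaining `i`-edge
  -- across the cut forms a rainbow triple with `x`.
  have h := hP (P.filter fun y => c x y = j) (P.filter fun y => c x y = k)
    (P.filter fun y => c x y = i) (hdis _ _ hjk) (hdis _ _ hji) (hdis _ _ hki) (by
      ext y
      have : c x y = i ∨ c x y = j ∨ c x y = k :=
        color_cases hji hki hjk _
      simp only [mem_union, mem_filter]
      tauto)
  rw [← colorDeg_eq_card, ← colorDeg_eq_card, ← colorDeg_eq_card] at h
  have hR : edgeSum c i (P.filter fun y => c x y = j) (P.filter fun y => c x y = k) ≤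
      ∑ y ∈ P, ∑ z ∈ P, if RainbowTriple c x y z then 1 else 0 := by
    rw [edgeSum, sum_filter]
    refine sum_le_sum fun y _ => ?_
    split_ifs with hy
    · rw [sum_filter]
      refine sum_le_sum fun z _ => ?_
      by_cases hz : c x z = k
      · by_cases hyz : c y z = i
        · rw [if_pos hz, if_pos hyz, if_pos]
          exact ⟨by rw [hy, hyz]; exact hji, by rw [hyz, hz]; exact hki.symm, by
            rw [hy, hz]; exact hjk⟩
        · rw [if_pos hz, if_neg hyz]
          split_ifs <;> norm_num
      · rw [if_neg hz]
        split_ifs <;> norm_num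
    · exact sum_nonneg fun z _ => by split_ifs <;> norm_num
  have h1 := colorDeg_add hji hki hjk c x P
  have h2 := colorDeg_nonneg c i x P
  have h3 := colorDeg_nonneg c j x P
  have h4 := colorDeg_nonneg c k x P
  set a := colorDeg c j x P
  set b := colorDeg c k x P
  set d := colorDeg c i x P
  set p : ℝ := (#P : ℝ)
  have hmm := min_mul_max a b
  have hmax : p - d ≤ 2 * max a b := by
    have := le_max_left a b
    have := le_max_right a b
    linarith
  have hmin : min a b ≤ p := (min_le_left _ _).trans (by linarith)
  have hmin0 : 0 ≤ min a b := le_min h3 h4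
  have h5 : min a b * (p - d) ≤ 2 * (a * b) := by
    have := mul_le_mul_of_nonneg_left hmax hmin0
    linarith
  have h6 : min a b * d ≤ p * d := mul_le_mul_of_nonneg_right hmin h2
  have h7 : θ * (min a b * p) ≤ θ * (2 * (a * b) + p * d) :=
    mul_le_mul_of_nonneg_left (by linarith) hθ
  linarith

end Pairs

/-! ### Recoloring along a partition into blocks. -/

section Blocks

variable {V : Type*}

/-- The number of ordered pairs in `W` on which `c` and `c'` differ. -/
noncomputable def diffSum (c c' : V → V → Fin 3) (W : Finset V) : ℝ :=
  ∑ x ∈ W, ∑ y ∈ W, if c x y ≠ c' x y then 1 else 0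

open Classical in
/-- The number of pairs in `Y` forming an ordered rainbow triple with `x`. -/
noncomputable def rainbowDeg (c : V → V → Fin 3) (x : V) (Y : Finset V) : ℝ :=
  ∑ y ∈ Y, ∑ z ∈ Y, if RainbowTriple c x y z then 1 else 0

theorem rainbowSum_eq (c : V → V → Fin 3) (W : Finset V) :
    rainbowSum c W = ∑ x ∈ W, rainbowDeg c x W := rfl

theorem rainbowDeg_nonneg (c : V → V → Fin 3) (x : V) (Y : Finset V) : 0 ≤ rainbowDeg c x Y :=
  sum_nonneg fun _ _ => sum_nonneg fun _ _ => by split_ifs <;> norm_num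

theorem rainbowSum_nonneg (c : V → V → Fin 3) (W : Finset V) : 0 ≤ rainbowSum c W :=
  sum_nonneg fun x _ => rainbowDeg_nonneg c x W

/-- `β` assigns to each element of `U` the part containing it in a partition of `U`. -/
structure IsBlockMap (U : Finset V) (β : V → Finset V) : Prop where
  mem_self : ∀ x ∈ U, x ∈ β x
  subset : ∀ x ∈ U, β x ⊆ U
  eq_of_mem : ∀ x ∈ U, ∀ y ∈ β x, β y = β x

variable [DecidableEq V] {U : Finset V} {β : V → Finset V}

theorem IsBlockMap.sum_blocks (h : IsBlockMap U β) (f : Finset V → V → ℝ) :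
    ∑ X ∈ U.image β, ∑ x ∈ X, f X x = ∑ x ∈ U, f (β x) x := by
  rw [← sum_fiberwise_of_maps_to (s := U) (t := U.image β) (g := β)
    (fun x hx => mem_image_of_mem β hx)]
  refine sum_congr rfl fun X hX => ?_
  obtain ⟨x₀, hx₀, rfl⟩ := mem_image.1 hX
  have h1 : U.filter (fun x => β x = β x₀) = β x₀ := by
    ext x
    rw [mem_filter]
    constructor
    · rintro ⟨hx, hxx⟩
      rw [← hxx]
      exact h.mem_self x hx
    · intro hx
      exact ⟨h.subset x₀ hx₀ hx, h.eq_of_mem x₀ hx₀ x hx⟩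
  rw [h1]
  refine sum_congr rfl fun x hx => ?_
  rw [h.eq_of_mem x₀ hx₀ x hx]

/-- The more frequent of the colors `j`, `k` between `X` and `Y`. -/
noncomputable def majority (c : V → V → Fin 3) (j k : Fin 3) (X Y : Finset V) : Fin 3 :=
  if edgeSum c k X Y ≤ edgeSum c j X Y then j else k

/-- Total deviation of single vertices from being monochromatic (in `j` or `k`) to other blocks. -/
noncomputable def blockDeviation (c : V → V → Fin 3) (j k : Fin 3) (U : Finset V)
    (β : V → Finset V) : ℝ :=
  ∑ x ∈ U, ∑ Y ∈ U.image β, if β x ≠ Y then min (colorDeg c j x Y) (colorDeg c k x Y) else 0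

/-- The number of ordered pairs of color `i` between different blocks. -/
noncomputable def blockCross (c : V → V → Fin 3) (i : Fin 3) (U : Finset V)
    (β : V → Finset V) : ℝ :=
  ∑ x ∈ U, ∑ y ∈ U, if β x ≠ β y ∧ c x y = i then 1 else 0

theorem IsBlockMap.sum_ne_majority_le (h : IsBlockMap U β) {c : V → V → Fin 3}
    (hc : ∀ x y, c x y = c y x) {i j k : Fin 3} (hji : j ≠ i) (hki : k ≠ i) (hjk : j ≠ k) :
    ∑ x ∈ U, ∑ y ∈ U, (if β x ≠ β y ∧ c x y ≠ majority c j k (β x) (β y) then (1 : ℝ) else 0) ≤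
      8 * blockDeviation c j k U β + 5 * blockCross c i U β := by
  have hpair : ∀ F : Finset V → Finset V → V → V → ℝ,
      ∑ x ∈ U, ∑ y ∈ U, F (β x) (β y) x y =
        ∑ X ∈ U.image β, ∑ Y ∈ U.image β, ∑ x ∈ X, ∑ y ∈ Y, F X Y x y := by
    intro F
    rw [← h.sum_blocks fun X x => ∑ y ∈ U, F X (β y) x y]
    refine sum_congr rfl fun X _ => ?_
    rw [sum_congr rfl fun x _ => (h.sum_blocks fun Y y => F X Y x y).symm]
    exact sum_comm
  have e1 : blockDeviation c j k U β = ∑ X ∈ U.image β, ∑ Y ∈ U.image β,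
      if X ≠ Y then ∑ x ∈ X, min (colorDeg c j x Y) (colorDeg c k x Y) else 0 := by
    rw [blockDeviation, ← h.sum_blocks fun X x => ∑ Y ∈ U.image β,
      if X ≠ Y then min (colorDeg c j x Y) (colorDeg c k x Y) else 0]
    refine sum_congr rfl fun X _ => ?_
    rw [sum_comm]
    refine sum_congr rfl fun Y _ => ?_
    split_ifs <;> simp
  have e2 : blockDeviation c j k U β = ∑ X ∈ U.image β, ∑ Y ∈ U.image β,
      if X ≠ Y then ∑ y ∈ Y, min (colorDeg c j y X) (colorDeg c k y X) else 0 := by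
    rw [e1, sum_comm]
    refine sum_congr rfl fun Y _ => sum_congr rfl fun X _ => ?_
    simp_rw [ne_comm]
  have e3 : blockCross c i U β = ∑ X ∈ U.image β, ∑ Y ∈ U.image β,
      if X ≠ Y then edgeSum c i X Y else 0 := by
    rw [blockCross, hpair fun X Y x y => if X ≠ Y ∧ c x y = i then 1 else 0]
    refine sum_congr rfl fun X _ => sum_congr rfl fun Y _ => ?_
    by_cases hXY : X = Y
    · simp [hXY]
    · simp only [ne_eq, hXY, not_false_eq_true, true_and, if_true, edgeSum]
  -- Rows and columns each contribute `4` times the deviation. Color `i` counts `4` times in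
  -- `min_edgeSum_le` and once more because its own pairs get recolored.
  have e4 : 8 * blockDeviation c j k U β + 5 * blockCross c i U β =
      4 * blockDeviation c j k U β + 4 * blockDeviation c j k U β + 5 * blockCross c i U β := by
    ring
  rw [e4]
  nth_rewrite 1 [e1]
  rw [e2, e3, hpair fun X Y x y => if X ≠ Y ∧ c x y ≠ majority c j k X Y then 1 else 0]
  simp_rw [mul_sum, ← sum_add_distrib]
  refine sum_le_sum fun X _ => sum_le_sum fun Y _ => ?_
  by_cases hXY : X = Y
  · simp [hXY]
  · simp only [ne_eq, hXY, not_false_eq_true, true_and, if_true]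
    have hmin := min_edgeSum_le hc hji hki hjk X Y
    have hle : ∑ x ∈ X, ∑ y ∈ Y, (if c x y ≠ majority c j k X Y then (1 : ℝ) else 0) ≤
        edgeSum c i X Y + min (edgeSum c j X Y) (edgeSum c k X Y) := by
      rw [majority]
      split_ifs with hle
      · rw [min_eq_right hle, edgeSum, edgeSum]
        simp_rw [← sum_add_distrib]
        refine sum_le_sum fun x _ => sum_le_sum fun y _ => ?_
        rcases color_cases hji hki hjk (c x y) with h | h | h <;>
          simp [h, hji, hki, hjk, hji.symm, hki.symm, hjk.symm]
      · rw [min_eq_left (le_of_not_ge hle), edgeSum, edgeSum]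
        simp_rw [← sum_add_distrib]
        refine sum_le_sum fun x _ => sum_le_sum fun y _ => ?_
        rcases color_cases hji hki hjk (c x y) with h | h | h <;>
          simp [h, hji, hki, hjk, hji.symm, hki.symm, hjk.symm]
    simp only [ne_eq] at hle
    linarith

/-- Colorings of the blocks extend to a coloring of `W` without rainbow triples: vertices of `Z`
get color `i` everywhere, and each pair of blocks gets its majority color among `j`, `k`. -/
theorem IsBlockMap.exists_coloring [Fintype V] {W Z : Finset V}
    (h : IsBlockMap (W.filter (· ∉ Z)) β) {c : V → V → Fin 3}
    (hc : ∀ x y, c x y = c y x) {i j k : Fin 3} (hji : j ≠ i) (hki : k ≠ i) (hjk : j ≠ k)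
    (g : Finset V → V → V → Fin 3) (hg : ∀ X x y, g X x y = g X y x)
    (hr : ∀ X ∈ (W.filter (· ∉ Z)).image β, ∀ x ∈ X, ∀ y ∈ X, ∀ z ∈ X,
      ¬ RainbowTriple (g X) x y z) :
    ∃ c' : V → V → Fin 3, (∀ x y, c' x y = c' y x) ∧
      (∀ x ∈ W, ∀ y ∈ W, ∀ z ∈ W, ¬ RainbowTriple c' x y z) ∧
      diffSum c c' W ≤ 2 * Fintype.card V * #Z +
        ∑ X ∈ (W.filter (· ∉ Z)).image β, diffSum c (g X) X +
        8 * blockDeviation c j k (W.filter (· ∉ Z)) β +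
        5 * blockCross c i (W.filter (· ∉ Z)) β := by
  set U := W.filter (· ∉ Z) with hU
  set c' : V → V → Fin 3 := fun x y =>
    if x ∈ Z ∨ y ∈ Z then i else
      if β x = β y then g (β x) x y else majority c j k (β x) (β y) with hc'
  have hmaj : ∀ X Y, majority c j k X Y = majority c j k Y X := by
    intro X Y
    rw [majority, majority, edgeSum_comm hc k X Y, edgeSum_comm hc j X Y]
  have hmajc : ∀ X Y, majority c j k X Y = j ∨ majority c j k X Y = k := by
    intro X Y
    rw [majority]
    split_ifs <;> simp
  have hsymm : ∀ x y, c' x y = c' y x := by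
    intro x y
    simp only [hc', or_comm (a := x ∈ Z)]
    split_ifs with h1 h2 h3 h3
    · rfl
    · rw [h2, hg]
    · exact absurd h2.symm h3
    · exact absurd h3.symm h2
    · exact hmaj _ _
  have hZ1 : ∀ x y, x ∈ Z → c' x y = i := fun x y hx => if_pos (Or.inl hx)
  have hZ2 : ∀ x y, y ∈ Z → c' x y = i := fun x y hy => if_pos (Or.inr hy)
  have hsame : ∀ x y, x ∉ Z → y ∉ Z → β x = β y → c' x y = g (β x) x y := by
    intro x y hx hy hxy
    simp only [hc']
    rw [if_neg (by tauto), if_pos hxy]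
  have hdiff : ∀ x y, x ∉ Z → y ∉ Z → β x ≠ β y → c' x y = majority c j k (β x) (β y) := by
    intro x y hx hy hxy
    simp only [hc']
    rw [if_neg (by tauto), if_neg hxy]
  refine ⟨c', hsymm, ?_, ?_⟩
  · intro x hx y hy z hz ⟨h1, h2, h3⟩
    by_cases hxZ : x ∈ Z
    · exact h3 ((hZ1 x y hxZ).trans (hZ1 x z hxZ).symm)
    by_cases hyZ : y ∈ Z
    · exact h1 ((hZ2 x y hyZ).trans (hZ1 y z hyZ).symm)
    by_cases hzZ : z ∈ Z
    · exact h2 ((hZ2 y z hzZ).trans (hZ2 x z hzZ).symm)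
    have hxU : x ∈ U := mem_filter.2 ⟨hx, hxZ⟩
    have hyU : y ∈ U := mem_filter.2 ⟨hy, hyZ⟩
    have hzU : z ∈ U := mem_filter.2 ⟨hz, hzZ⟩
    -- With exactly two vertices in one block, the third sees both in the same color; with three
    -- different blocks, only the two colors `j`, `k` are available.
    by_cases hxy : β x = β y
    · by_cases hyz : β y = β z
      · have hy' : y ∈ β x := hxy ▸ h.mem_self y hyU
        have hz' : z ∈ β x := (hxy.trans hyz) ▸ h.mem_self z hzU
        rw [hsame x y hxZ hyZ hxy, hsame y z hyZ hzZ hyz, ← hxy] at h1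
        rw [hsame y z hyZ hzZ hyz, hsame x z hxZ hzZ (hxy.trans hyz), ← hxy] at h2
        rw [hsame x y hxZ hyZ hxy, hsame x z hxZ hzZ (hxy.trans hyz)] at h3
        exact hr (β x) (mem_image_of_mem β hxU) x (h.mem_self x hxU) y hy' z hz' ⟨h1, h2, h3⟩
      · refine h2 ?_
        rw [hdiff y z hyZ hzZ hyz, hdiff x z hxZ hzZ (hxy ▸ hyz), hxy]
    · by_cases hyz : β y = β z
      · refine h3 ?_
        rw [hdiff x y hxZ hyZ hxy, hdiff x z hxZ hzZ (hyz ▸ hxy), hyz]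
      · by_cases hxz : β x = β z
        · refine h1 ?_
          rw [hdiff x y hxZ hyZ hxy, hdiff y z hyZ hzZ hyz, hmaj, hxz]
        · rw [hdiff x y hxZ hyZ hxy, hdiff y z hyZ hzZ hyz] at h1
          rw [hdiff y z hyZ hzZ hyz, hdiff x z hxZ hzZ hxz] at h2
          rw [hdiff x y hxZ hyZ hxy, hdiff x z hxZ hzZ hxz] at h3
          rcases hmajc (β x) (β y) with p | p <;> rcases hmajc (β y) (β z) with q | q <;>
            rcases hmajc (β x) (β z) with r | r <;> simp_all
  · have hsplit : ∀ F : V → V → ℝ, (∀ x y, 0 ≤ F x y) → (∀ x y, F x y ≤ 1) →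
        ∑ x ∈ W, ∑ y ∈ W, F x y ≤ 2 * Fintype.card V * #Z + ∑ x ∈ U, ∑ y ∈ U, F x y := by
      intro F h0 h1
      have hle : ∀ x y, F x y ≤ (if x ∈ Z then (1 : ℝ) else 0) + (if y ∈ Z then (1 : ℝ) else 0) +
          if x ∉ Z then (if y ∉ Z then F x y else 0) else 0 := by
        intro x y
        have := h0 x y
        have := h1 x y
        split_ifs <;> linarith
      refine (sum_le_sum fun x _ => sum_le_sum fun y _ => hle x y).trans ?_
      simp_rw [sum_add_distrib]
      have s1 : ∑ x ∈ W, (if x ∈ Z then (1 : ℝ) else 0) ≤ #Z := by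
        rw [sum_boole]
        exact_mod_cast card_le_card (fun x hx => (mem_filter.1 hx).2)
      have s0 : (#W : ℝ) ≤ Fintype.card V := by exact_mod_cast card_le_univ W
      have s2 : ∑ x ∈ W, ∑ y ∈ W, (if x ∉ Z then (if y ∉ Z then F x y else 0) else 0) =
          ∑ x ∈ U, ∑ y ∈ U, F x y := by
        rw [hU, sum_filter]
        refine sum_congr rfl fun x _ => ?_
        split_ifs
        · simp
        · rw [sum_filter]
      have s3 : ∑ x ∈ W, ∑ _y ∈ W, (if x ∈ Z then (1 : ℝ) else 0) ≤ Fintype.card V * #Z := by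
        rw [sum_comm, sum_const, nsmul_eq_mul]
        exact mul_le_mul s0 s1 (sum_nonneg fun _ _ => by split_ifs <;> norm_num) (by positivity)
      have s4 : ∑ _x ∈ W, ∑ y ∈ W, (if y ∈ Z then (1 : ℝ) else 0) ≤ Fintype.card V * #Z := by
        rw [sum_const, nsmul_eq_mul]
        exact mul_le_mul s0 s1 (sum_nonneg fun _ _ => by split_ifs <;> norm_num) (by positivity)
      rw [s2]
      linarith
    have h1 := hsplit (fun x y => if c x y ≠ c' x y then 1 else 0)
      (fun x y => by split_ifs <;> norm_num)
      (fun x y => by split_ifs <;> norm_num)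
    have h2 : ∑ x ∈ U, ∑ y ∈ U, (if c x y ≠ c' x y then (1 : ℝ) else 0) ≤
        ∑ X ∈ U.image β, diffSum c (g X) X +
        ∑ x ∈ U, ∑ y ∈ U,
          (if β x ≠ β y ∧ c x y ≠ majority c j k (β x) (β y) then (1 : ℝ) else 0) := by
      have e1 : ∑ X ∈ U.image β, diffSum c (g X) X =
          ∑ x ∈ U, ∑ y ∈ β x, if c x y ≠ g (β x) x y then (1 : ℝ) else 0 :=
        h.sum_blocks fun X x => ∑ y ∈ X, if c x y ≠ g X x y then (1 : ℝ) else 0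
      rw [e1, ← sum_add_distrib]
      refine sum_le_sum fun x hx => ?_
      have e2 : ∑ y ∈ β x, (if c x y ≠ g (β x) x y then (1 : ℝ) else 0) =
          ∑ y ∈ U, if y ∈ β x then (if c x y ≠ g (β x) x y then (1 : ℝ) else 0) else 0 := by
        rw [← sum_filter (fun y => y ∈ β x), filter_mem_eq_inter, inter_eq_right.2 (h.subset x hx)]
      rw [e2, ← sum_add_distrib]
      refine sum_le_sum fun y hy => ?_
      have hxZ := (mem_filter.1 hx).2
      have hyZ := (mem_filter.1 hy).2
      by_cases hxy : β x = β y
      · have hy' : y ∈ β x := hxy ▸ h.mem_self y hy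
        rw [hsame x y hxZ hyZ hxy, if_pos hy']
        refine le_add_of_nonneg_right ?_
        split_ifs <;> norm_num
      · rw [hdiff x y hxZ hyZ hxy]
        have : y ∉ β x := fun hy' => hxy (h.eq_of_mem x hx y hy').symm
        rw [if_neg this, zero_add]
        simp [hxy]
    have h3 := h.sum_ne_majority_le hc hji hki hjk
    rw [diffSum]
    linarith

end Blocks

/-! ### The recursive decomposition. -/

theorem sum_sum_filter_notMem {V : Type*} {W Z : Finset V} [DecidableEq V] (F : V → V → ℝ) :
    ∑ x ∈ W.filter (· ∉ Z), ∑ y ∈ W.filter (· ∉ Z), F x y =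
      ∑ x ∈ W, ∑ y ∈ W, if x ∉ Z ∧ y ∉ Z then F x y else 0 := by
  rw [sum_filter]
  refine sum_congr rfl fun x _ => ?_
  by_cases hx : x ∈ Z
  · simp [hx]
  · simp [hx, sum_filter]

section Main

variable {V : Type*} [Fintype V]

open Classical in
/-- One step of the decomposition: if color `i` has a sparse cut in `W`, then `W` is split along an
extremal partition and the large classes are recolored by `ih`. -/
theorem exists_coloring_of_sparse_cut {c : V → V → Fin 3} (hc : ∀ x y, c x y = c y x)
    {η κ θ a b : ℝ} (hη : 0 < η) (hκ : 0 < κ) (hθ : 0 < θ) (ha0 : 0 ≤ a)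
    (ha : θ * (1 / κ + 5 + 8 * ((2 * κ + θ) / (θ * η))) ≤ a)
    (hb : 16 / (θ * (η * Fintype.card V)) ≤ b) {W : Finset V}
    (ih : ∀ P : Finset V, P ⊂ W → ∃ c' : V → V → Fin 3, (∀ x y, c' x y = c' y x) ∧
      (∀ x ∈ P, ∀ y ∈ P, ∀ z ∈ P, ¬ RainbowTriple c' x y z) ∧
      diffSum c c' P ≤ a * (#P : ℝ) ^ 2 + b * rainbowSum c P + 5 * η * Fintype.card V * #P)
    {i : Fin 3} {A₀ B₀ : Finset V} (hdis : Disjoint A₀ B₀) (hun : A₀ ∪ B₀ = W)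
    (hcut : edgeSum c i A₀ B₀ < θ * #A₀ * #B₀) :
    ∃ c' : V → V → Fin 3, (∀ x y, c' x y = c' y x) ∧
      (∀ x ∈ W, ∀ y ∈ W, ∀ z ∈ W, ¬ RainbowTriple c' x y z) ∧
      diffSum c c' W ≤ a * (#W : ℝ) ^ 2 + b * rainbowSum c W + 5 * η * Fintype.card V * #W := by
  have hn : (0 : ℝ) < Fintype.card V := by
    rcases (Nat.cast_nonneg (α := ℝ) (Fintype.card V)).eq_or_lt with h | h
    · have h0 : (#A₀ : ℝ) ≤ Fintype.card V := by exact_mod_cast card_le_univ A₀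
      have h1 : (#A₀ : ℝ) = 0 := le_antisymm (h0.trans h.symm.le) (Nat.cast_nonneg _)
      rw [h1, mul_zero, zero_mul] at hcut
      exact absurd (edgeSum_nonneg c i A₀ B₀) (not_le.2 hcut)
    · exact h
  set n : ℝ := (Fintype.card V : ℝ) with hn_def
  obtain ⟨j, k, hji, hki, hjk⟩ := exists_two_other_colors i
  obtain ⟨Z, r, hF, hsep⟩ := exists_extremal_partition hc i W
    (mul_pos hκ hn).le hθ.le
  set U := W.filter (· ∉ Z) with hU
  have hUW : U ⊆ W := filter_subset _ _
  set cl : V → Finset V := fun x => W.filter fun y => y ∉ Z ∧ r x y with hcl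
  have hclU : ∀ x, cl x ⊆ U := by
    intro x y hy
    rw [hcl, mem_filter] at hy
    exact mem_filter.2 ⟨hy.1, hy.2.1⟩
  have hmem_cl : ∀ x, ∀ y ∈ U, y ∈ cl x ↔ r x y := by
    intro x y hy
    rw [hU, mem_filter] at hy
    simp [hcl, hy.1, hy.2]
  have hcl_eq : ∀ x y, r x y → cl x = cl y := by
    intro x y hxy
    ext z
    simp only [hcl, mem_filter]
    have : r x z ↔ r y z := ⟨fun h => r.trans (r.symm hxy) h, fun h => r.trans hxy h⟩
    rw [this]
  set lg : V → Prop := fun x => η * n ≤ #(cl x) with hlg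
  -- Small classes are broken into singletons: every vertex is exactly monochromatic to a singleton,
  -- and nothing is left to recurse on.
  set β : V → Finset V := fun x => if lg x then cl x else {x} with hβ
  have hβlg : ∀ x, lg x → β x = cl x := fun x hx => if_pos hx
  have hβsm : ∀ x, ¬ lg x → β x = {x} := fun x hx => if_neg hx
  have hlg_eq : ∀ x y, r x y → lg x → lg y := by
    intro x y hxy hx
    simp only [hlg] at hx ⊢
    rwa [← hcl_eq x y hxy]
  have hβ_eq : ∀ x y, r x y → lg x → β x = β y := by
    intro x y hxy hx
    rw [hβlg x hx, hβlg y (hlg_eq x y hxy hx), hcl_eq x y hxy]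
  have hblock : IsBlockMap U β := by
    refine ⟨fun x hx => ?_, fun x hx => ?_, fun x hx y hy => ?_⟩
    · by_cases h : lg x
      · rw [hβlg x h]; exact (hmem_cl x x hx).2 (r.refl x)
      · rw [hβsm x h]; exact mem_singleton_self x
    · by_cases h : lg x
      · rw [hβlg x h]; exact hclU x
      · rw [hβsm x h]; exact singleton_subset_iff.2 hx
    · by_cases h : lg x
      · rw [hβlg x h] at hy
        exact (hβ_eq x y ((hmem_cl x y (hclU x hy)).1 hy) h).symm
      · rw [hβsm x h, mem_singleton] at hy
        rw [hy]
  -- This is where the sparse cut decides: a class equal to `W` could not be inseparable, so the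
  -- induction hypothesis applies to every class.
  have hproper : ∀ x, cl x ⊂ W := by
    intro x
    refine ((hclU x).trans hUW).ssubset_of_ne fun h => ?_
    have h1 := hsep x A₀ B₀ ∅ hdis (disjoint_empty_right _) (disjoint_empty_right _)
      (by rw [union_empty, hun]; exact h.symm)
    simp only [card_empty, CharP.cast_eq_zero, mul_zero, add_zero] at h1
    linarith
  set w : V → ℝ := fun x => if lg x then a * #(cl x) + 5 * η * n else 0 with hw
  have hex : ∀ X, ∃ g : V → V → Fin 3, (∀ x y, g x y = g y x) ∧ (X ∈ U.image β →
      (∀ x ∈ X, ∀ y ∈ X, ∀ z ∈ X, ¬ RainbowTriple g x y z) ∧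
      diffSum c g X ≤ b * rainbowSum c X + ∑ x ∈ X, w x) := by
    intro X
    by_cases hX : X ∈ U.image β
    · obtain ⟨x₀, hx₀, rfl⟩ := mem_image.1 hX
      by_cases h : lg x₀
      · rw [hβlg x₀ h]
        obtain ⟨g, hg, hg1, hg2⟩ := ih (cl x₀) (hproper x₀)
        refine ⟨g, hg, fun _ => ⟨hg1, hg2.trans (le_of_eq ?_)⟩⟩
        have hwx : ∀ x ∈ cl x₀, w x = a * #(cl x₀) + 5 * η * n := by
          intro x hx
          have hr := (hmem_cl x₀ x (hclU x₀ hx)).1 hx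
          simp only [hw]
          rw [if_pos (hlg_eq x₀ x hr h), hcl_eq x₀ x hr]
        rw [sum_congr rfl hwx, sum_const, nsmul_eq_mul]
        ring
      · rw [hβsm x₀ h]
        refine ⟨c, hc, fun _ => ⟨?_, ?_⟩⟩
        · intro x hx y hy z hz hr
          rw [mem_singleton] at hx hy hz
          subst hx hy hz
          exact hr.1 rfl
        · have h1 : diffSum c c {x₀} = 0 := by simp [diffSum]
          have h2 : w x₀ = 0 := if_neg h
          rw [h1, sum_singleton, h2, add_zero]
          exact mul_nonneg (le_trans (by positivity) hb) (rainbowSum_nonneg c _)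
    · exact ⟨c, hc, fun h => absurd h hX⟩
  choose g hg hgX using hex
  obtain ⟨c', hc'1, hc'2, hc'3⟩ := IsBlockMap.exists_coloring (Z := Z) hblock hc hji hki hjk g hg
    (fun X hX => (hgX X hX).1)
  refine ⟨c', hc'1, hc'2, hc'3.trans ?_⟩
  have hcrossU : crossSum c i W Z r =
      ∑ x ∈ U, ∑ y ∈ U, if ¬ r x y ∧ c x y = i then (1 : ℝ) else 0 := by
    rw [crossSum, sum_sum_filter_notMem]
    refine sum_congr rfl fun x _ => sum_congr rfl fun y _ => ?_
    rw [← ite_and]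
    congr 1
    rw [and_assoc]
  have hsameU : sameSum W Z r = ∑ x ∈ U, (#(cl x) : ℝ) := by
    have h1 : ∀ x, (#(cl x) : ℝ) = ∑ y ∈ U, if r x y then (1 : ℝ) else 0 := by
      intro x
      rw [sum_boole]
      congr 2
      ext y
      simp only [hcl, hU, mem_filter, and_assoc]
    simp_rw [h1]
    rw [sameSum, sum_sum_filter_notMem]
    refine sum_congr rfl fun x _ => sum_congr rfl fun y _ => ?_
    rw [← ite_and]
    congr 1
    rw [and_assoc]
  have hcross0 : 0 ≤ crossSum c i W Z r :=
    sum_nonneg fun _ _ => sum_nonneg fun _ _ => by split_ifs <;> norm_num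
  set Rd : ℝ := ∑ x ∈ U, ∑ Y ∈ U.image β, if β x ≠ Y then rainbowDeg c x Y else 0 with hRd
  set Rs : ℝ := ∑ X ∈ U.image β, rainbowSum c X with hRs
  -- Triples inside a block are left to the recursion, while this level is charged for triples whose
  -- last two vertices share a block that misses the first. The two families are disjoint.
  have hR : Rs + Rd ≤ rainbowSum c W := by
    have e1 : Rs = ∑ x ∈ U, rainbowDeg c x (β x) := hblock.sum_blocks fun X x => rainbowDeg c x X
    have e2 : rainbowSum c U ≤ rainbowSum c W := by
      rw [rainbowSum, rainbowSum]
      have h0 : ∀ x y z, (0 : ℝ) ≤ if RainbowTriple c x y z then 1 else 0 := by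
        intro x y z
        split_ifs <;> norm_num
      exact (sum_le_sum_of_subset_of_nonneg hUW fun x _ _ =>
          sum_nonneg fun y _ => sum_nonneg fun z _ => h0 x y z).trans
        (sum_le_sum fun x _ => (sum_le_sum_of_subset_of_nonneg hUW fun y _ _ =>
          sum_nonneg fun z _ => h0 x y z).trans
        (sum_le_sum fun y _ => sum_le_sum_of_subset_of_nonneg hUW fun z _ _ => h0 x y z))
    refine le_trans ?_ e2
    rw [e1, hRd, ← sum_add_distrib, rainbowSum_eq]
    refine sum_le_sum fun x hx => ?_
    have h1 : rainbowDeg c x U = ∑ Y ∈ U.image β, ∑ y ∈ Y, ∑ z ∈ U,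
        if RainbowTriple c x y z then (1 : ℝ) else 0 :=
      (hblock.sum_blocks fun _ y => ∑ z ∈ U,
        if RainbowTriple c x y z then (1 : ℝ) else 0).symm
    have h2 : ∑ Y ∈ U.image β, rainbowDeg c x Y ≤ rainbowDeg c x U := by
      rw [h1]
      refine sum_le_sum fun Y hY => sum_le_sum fun y _ => ?_
      obtain ⟨x₀, hx₀, rfl⟩ := mem_image.1 hY
      exact sum_le_sum_of_subset_of_nonneg (hblock.subset x₀ hx₀) fun z _ _ => by
        split_ifs <;> norm_num
    refine le_trans (le_of_eq ?_) h2
    have : (U.image β).filter (fun Y => ¬ β x ≠ Y) = {β x} := by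
      ext Y
      simp only [mem_filter, mem_singleton, not_not]
      constructor
      · rintro ⟨-, h⟩; exact h.symm
      · rintro rfl; exact ⟨mem_image_of_mem β hx, rfl⟩
    rw [← sum_filter, ← sum_filter_add_sum_filter_not (U.image β) (fun Y => β x ≠ Y)
      (rainbowDeg c x), this, sum_singleton, add_comm]
  have hdev : blockDeviation c j k U β ≤ 2 / (θ * (η * n)) * Rd +
      (2 * κ + θ) / (θ * η) * crossSum c i W Z r := by
    have e3 : crossSum c i W Z r = ∑ x ∈ U, ∑ Y ∈ U.image β, ∑ y ∈ Y,
        if ¬ r x y ∧ c x y = i then (1 : ℝ) else 0 := by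
      rw [hcrossU]
      refine sum_congr rfl fun x _ => ?_
      exact (hblock.sum_blocks fun _ y => if ¬ r x y ∧ c x y = i then (1 : ℝ) else 0).symm
    rw [blockDeviation, hRd, e3]
    simp_rw [mul_sum (U)]
    rw [← sum_add_distrib]
    refine sum_le_sum fun x hx => ?_
    rw [mul_sum, mul_sum, ← sum_add_distrib]
    refine sum_le_sum fun Y hY => ?_
    obtain ⟨x₀, hx₀, rfl⟩ := mem_image.1 hY
    have hnn : (0 : ℝ) ≤ ∑ y ∈ β x₀, if ¬ r x y ∧ c x y = i then (1 : ℝ) else 0 :=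
      sum_nonneg fun _ _ => by split_ifs <;> norm_num
    have hRnn := rainbowDeg_nonneg c x (β x₀)
    by_cases hne : β x ≠ β x₀
    · rw [if_pos hne, if_pos hne]
      by_cases h : lg x₀
      · have hd : colorDeg c i x (β x₀) =
            ∑ y ∈ β x₀, if ¬ r x y ∧ c x y = i then (1 : ℝ) else 0 := by
          rw [colorDeg]
          refine sum_congr rfl fun y hy => ?_
          have : ¬ r x y := by
            intro hxy
            rw [hβlg x₀ h] at hy
            have h1 := (hmem_cl x₀ y (hclU x₀ hy)).1 hy
            exact hne (hβ_eq x₀ x (r.trans h1 (r.symm hxy)) h).symm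
          simp [this]
        rw [← hd]
        have h1 := min_colorDeg_le hji hki hjk hθ.le
          (fun A B D h1 h2 h3 h4 => hsep x₀ A B D h1 h2 h3 (h4.trans (hβlg x₀ h))) x
        have h2 : η * n ≤ #(β x₀) := by rw [hβlg x₀ h]; exact h
        have h3 : (#(β x₀) : ℝ) ≤ n := by rw [hn_def]; exact_mod_cast card_le_univ _
        have h4 := colorDeg_nonneg c i x (β x₀)
        set t := min (colorDeg c j x (β x₀)) (colorDeg c k x (β x₀)) with ht
        have ht0 : 0 ≤ t := le_min (colorDeg_nonneg _ _ _ _) (colorDeg_nonneg _ _ _ _)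
        have h5 : θ * t * (η * n) ≤ 2 * rainbowDeg c x (β x₀) +
            (2 * (κ * n) + θ * n) * colorDeg c i x (β x₀) := by
          refine le_trans ?_ (h1.trans ?_)
          · gcongr
          · rw [rainbowDeg]
            gcongr
        have h6 : t * (θ * (η * n)) ≤ (2 / (θ * (η * n)) * rainbowDeg c x (β x₀) +
            (2 * κ + θ) / (θ * η) * colorDeg c i x (β x₀)) * (θ * (η * n)) := by
          have e : (2 / (θ * (η * n)) * rainbowDeg c x (β x₀) +
            (2 * κ + θ) / (θ * η) * colorDeg c i x (β x₀)) * (θ * (η * n)) =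
            2 * rainbowDeg c x (β x₀) + (2 * (κ * n) + θ * n) * colorDeg c i x (β x₀) := by
            field_simp
          rw [e]
          linarith
        exact le_of_mul_le_mul_right h6 (by positivity)
      · have h0 : min (colorDeg c j x (β x₀)) (colorDeg c k x (β x₀)) = 0 := by
          rw [hβsm x₀ h, colorDeg, colorDeg, sum_singleton, sum_singleton]
          by_cases h1 : c x x₀ = j
          · have h2 : c x x₀ ≠ k := by rw [h1]; exact hjk
            rw [if_neg h2]
            exact min_eq_right (by split_ifs; norm_num)
          · rw [if_neg h1]
            exact min_eq_left (by split_ifs <;> norm_num)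
        rw [h0]
        positivity
    · rw [if_neg hne, if_neg hne]
      positivity
  -- The excess comes from `i`-edges inside small classes, which now join different singletons: at
  -- most `η * n` per vertex.
  have hbc : blockCross c i U β ≤ crossSum c i W Z r + ∑ x ∈ U, if lg x then 0 else η * n := by
    rw [blockCross, hcrossU, ← sum_add_distrib]
    refine sum_le_sum fun x hx => ?_
    split_ifs with h
    · rw [add_zero]
      refine sum_le_sum fun y hy => ?_
      by_cases h1 : β x ≠ β y ∧ c x y = i
      · have h2 : ¬ r x y := fun h' => h1.1 (hβ_eq x y h' h)
        rw [if_pos h1, if_pos ⟨h2, h1.2⟩]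
      · rw [if_neg h1]
        split_ifs <;> norm_num
    · have h1 : ∑ y ∈ U, (if r x y then (1 : ℝ) else 0) ≤ η * n := by
        have h2 : ∑ y ∈ U, (if r x y then (1 : ℝ) else 0) = #(cl x) := by
          rw [sum_boole]
          congr 2
          ext y
          simp only [hcl, hU, mem_filter, and_assoc]
        rw [h2]
        exact (not_le.1 h).le
      refine le_trans ?_ (add_le_add le_rfl h1)
      rw [← sum_add_distrib]
      refine sum_le_sum fun y _ => ?_
      by_cases h3 : r x y
      · simp only [h3, not_true_eq_false, false_and, if_false, if_true]
        split_ifs <;> norm_num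
      · simp only [h3, not_false_eq_true, true_and, if_false, add_zero]
        by_cases h4 : c x y = i
        · simp only [h4, if_true]
          split_ifs <;> norm_num
        · simp [h4]
  have hblocks : ∑ X ∈ U.image β, diffSum c (g X) X ≤ b * Rs + ∑ x ∈ U, w x := by
    have h1 := hblock.sum_blocks fun _ x => w x
    rw [← h1, hRs, mul_sum, ← sum_add_distrib]
    exact sum_le_sum fun X hX => (hgX X hX).2
  -- A vertex of a large class hands its allowance `5 * η * n` to the recursion, and one of a small
  -- class spends it here; never both.
  have hwsum : ∑ x ∈ U, w x + 5 * ∑ x ∈ U, (if lg x then 0 else η * n) ≤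
      a * sameSum W Z r + 5 * η * n * #W := by
    have h1 : (#U : ℝ) ≤ #W := by exact_mod_cast card_le_card hUW
    have h2 : ∑ x ∈ U, w x + 5 * ∑ x ∈ U, (if lg x then 0 else η * n) ≤
        ∑ x ∈ U, (a * #(cl x) + 5 * η * n) := by
      rw [mul_sum, ← sum_add_distrib]
      refine sum_le_sum fun x _ => ?_
      simp only [hw]
      have : 0 ≤ a * #(cl x) := by positivity
      split_ifs <;> linarith
    rw [sum_add_distrib, ← mul_sum, ← hsameU, sum_const, nsmul_eq_mul] at h2
    have h3 : #U * (5 * η * n) ≤ 5 * η * n * #W := by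
      rw [mul_comm]
      gcongr
    linarith
  have hRd0 : 0 ≤ Rd := sum_nonneg fun x _ => sum_nonneg fun Y _ => by
    split_ifs
    · exact rainbowDeg_nonneg c x Y
    · exact le_rfl
  have hbR : b * Rs + 16 / (θ * (η * n)) * Rd ≤ b * rainbowSum c W := by
    have h1 := mul_le_mul_of_nonneg_right hb hRd0
    have h2 := mul_le_mul_of_nonneg_left hR (le_trans (by positivity) hb)
    linarith
  -- The term `1 / κ` turns the deletion weight `2 * κ * n` into the `2 * n` pairs recolored per
  -- deleted vertex; the rest is the total price of a crossing `i`-edge.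
  set L : ℝ := 1 / κ + 5 + 8 * ((2 * κ + θ) / (θ * η)) with hL
  have hZ : 2 * n * #Z + (5 + 8 * ((2 * κ + θ) / (θ * η))) * crossSum c i W Z r ≤
      L * (crossSum c i W Z r + 2 * (κ * n) * #Z) := by
    have e : L * (crossSum c i W Z r + 2 * (κ * n) * #Z) =
        2 * n * #Z + (5 + 8 * ((2 * κ + θ) / (θ * η))) * crossSum c i W Z r +
        (1 / κ * crossSum c i W Z r +
          (5 + 8 * ((2 * κ + θ) / (θ * η))) * (2 * (κ * n) * #Z)) := by
      rw [hL]
      field_simp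
      ring
    rw [e]
    have : 0 ≤ 1 / κ * crossSum c i W Z r +
          (5 + 8 * ((2 * κ + θ) / (θ * η))) * (2 * (κ * n) * #Z) := by positivity
    linarith
  have hL0 : 0 ≤ L := by positivity
  have hF' := mul_le_mul_of_nonneg_left hF hL0
  have hsame_le : sameSum W Z r ≤ (#W : ℝ) ^ 2 := by
    have : θ * sameSum W Z r ≤ θ * (#W : ℝ) ^ 2 := by
      have : 0 ≤ 2 * (κ * n) * (#Z : ℝ) := by positivity
      linarith
    exact le_of_mul_le_mul_left this hθ
  have hfin : L * (crossSum c i W Z r + 2 * (κ * n) * #Z) + a * sameSum W Z r ≤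
      a * (#W : ℝ) ^ 2 := by
    have h1 := mul_le_mul_of_nonneg_right ha (sub_nonneg.2 hsame_le)
    linarith
  have h16 : 16 / (θ * (η * n)) * Rd = 8 * (2 / (θ * (η * n)) * Rd) := by ring
  linarith

/-- Colorings with few rainbow triples can be made free of them by few changes. -/
theorem exists_coloring_diffSum_le {c : V → V → Fin 3} (hc : ∀ x y, c x y = c y x)
    {η κ θ a b : ℝ} (hη : 0 < η) (hκ : 0 < κ) (hθ : 0 < θ) (hθ1 : θ ≤ 1) (ha0 : 0 ≤ a)
    (ha : θ * (1 / κ + 5 + 8 * ((2 * κ + θ) / (θ * η))) ≤ a)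
    (hb : 16 / (θ * (η * Fintype.card V)) ≤ b) {k : ℕ}
    (hk : 3 * (k + 1) * (1 - θ ^ 2) ^ k ≤ 1 / 4)
    (hbk : 2 * (k + 2) ^ 3 / (η * Fintype.card V) ≤ b) (hn : 4 ≤ η * Fintype.card V)
    (W : Finset V) :
    ∃ c' : V → V → Fin 3, (∀ x y, c' x y = c' y x) ∧
      (∀ x ∈ W, ∀ y ∈ W, ∀ z ∈ W, ¬ RainbowTriple c' x y z) ∧
      diffSum c c' W ≤ a * (#W : ℝ) ^ 2 + b * rainbowSum c W + 5 * η * Fintype.card V * #W := by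
  classical
  induction W using Finset.strongInduction with
  | H W ih =>
    have hb0 : 0 ≤ b := le_trans (by positivity) hb
    have hR0 := rainbowSum_nonneg c W
    have htriv : (#W : ℝ) ^ 2 ≤
        a * (#W : ℝ) ^ 2 + b * rainbowSum c W + 5 * η * Fintype.card V * #W →
        ∃ c' : V → V → Fin 3, (∀ x y, c' x y = c' y x) ∧
        (∀ x ∈ W, ∀ y ∈ W, ∀ z ∈ W, ¬ RainbowTriple c' x y z) ∧
        diffSum c c' W ≤ a * (#W : ℝ) ^ 2 + b * rainbowSum c W + 5 * η * Fintype.card V * #W := by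
      intro h
      refine ⟨fun _ _ => 0, fun _ _ => rfl, fun _ _ _ _ _ _ hr => hr.1 rfl, le_trans ?_ h⟩
      calc diffSum c (fun _ _ => 0) W ≤ ∑ _x ∈ W, ∑ _y ∈ W, (1 : ℝ) :=
            sum_le_sum fun _ _ => sum_le_sum fun _ _ => by split_ifs <;> norm_num
        _ = _ := by simp [sq]
    -- Two cases make the constant coloring affordable: a small `W` is paid for by the per-vertex
    -- allowance, and dense cuts in all colors by the rainbow count.
    by_cases hsmall : (#W : ℝ) < η * Fintype.card V
    · refine htriv ?_
      have h1 : (#W : ℝ) ^ 2 ≤ η * Fintype.card V * #W := by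
        rw [sq]; gcongr
      have h2 : 0 ≤ a * (#W : ℝ) ^ 2 := by positivity
      have h3 : 0 ≤ b * rainbowSum c W := by positivity
      have h4 : 0 ≤ η * Fintype.card V * #W := by positivity
      linarith
    push Not at hsmall
    by_cases hcut : ∀ i, ∀ A B : Finset V, Disjoint A B → A ∪ B = W →
        θ * #A * #B ≤ edgeSum c i A B
    · refine htriv ?_
      have hW4 : 4 ≤ #W := by exact_mod_cast hn.trans hsmall
      have h1 := card_pow_three_le_of_cut_finset hc hθ.le hθ1 hcut hk hW4
      have hW0 : (0 : ℝ) < #W := by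
        have : 0 < #W := by omega
        exact_mod_cast this
      have h2 : (#W : ℝ) ^ 2 ≤ b * rainbowSum c W := by
        have hbb : 2 * (k + 2) ^ 3 ≤ b * #W := by
          rw [div_le_iff₀ (by linarith)] at hbk
          exact hbk.trans (by gcongr)
        have h3 : (#W : ℝ) ^ 2 * #W ≤ b * rainbowSum c W * #W := by
          calc (#W : ℝ) ^ 2 * #W = (#W : ℝ) ^ 3 := by ring
            _ ≤ _ := h1
            _ ≤ b * #W * rainbowSum c W := by gcongr
            _ = _ := by ring
        exact le_of_mul_le_mul_right h3 hW0
      have h3 : 0 ≤ a * (#W : ℝ) ^ 2 := by positivity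
      have h4 : 0 ≤ 5 * η * Fintype.card V * #W := by positivity
      linarith
    · push Not at hcut
      obtain ⟨i, A, B, hdis, hun, hlt⟩ := hcut
      exact exists_coloring_of_sparse_cut hc hη hκ hθ ha0 ha hb ih hdis hun hlt

end Main

/-! ### Translation between edge labelings and symmetric pair colorings. -/

section EdgeLabeling

variable {V : Type*}

open Classical in
/-- The coloring of ordered pairs underlying a labeling of the edges of the complete graph, with an
arbitrary value on the diagonal. -/
noncomputable def pairColor (C : SimpleGraph.TopEdgeLabeling V (Fin 3)) (x y : V) : Fin 3 :=
  if h : (⊤ : SimpleGraph V).Adj x y then C.get x y h else 0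

theorem pairColor_of_adj (C : SimpleGraph.TopEdgeLabeling V (Fin 3)) {x y : V}
    (h : (⊤ : SimpleGraph V).Adj x y) : pairColor C x y = C.get x y h := dif_pos h

theorem pairColor_comm (C : SimpleGraph.TopEdgeLabeling V (Fin 3)) (x y : V) :
    pairColor C x y = pairColor C y x := by
  by_cases h : (⊤ : SimpleGraph V).Adj x y
  · rw [pairColor_of_adj C h, pairColor_of_adj C h.symm, SimpleGraph.EdgeLabeling.get_comm]
  · rw [pairColor, pairColor, dif_neg h, dif_neg fun h' => h h'.symm]

theorem RainbowTriple.ne {c : V → V → Fin 3} (hc : ∀ x y, c x y = c y x) {x y z : V}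
    (h : RainbowTriple c x y z) : x ≠ y ∧ y ≠ z ∧ x ≠ z := by
  refine ⟨?_, ?_, ?_⟩ <;> rintro rfl
  · exact h.2.1 rfl
  · exact h.2.2 rfl
  · exact h.1 (hc _ _)

theorem RainbowTriple.mem_rainbowTriangles [DecidableEq V]
    {C : SimpleGraph.TopEdgeLabeling V (Fin 3)} {x y z : V}
    (h : RainbowTriple (pairColor C) x y z) : ({x, y, z} : Finset V) ∈ rainbowTriangles C := by
  obtain ⟨h1, h2, h3⟩ := h.ne (pairColor_comm C)
  refine ⟨x, y, z, h1, h2, h3, by simp, ?_⟩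
  rw [← pairColor_of_adj, ← pairColor_of_adj, ← pairColor_of_adj]
  exact h

/-- A rainbow vertex set `T` accounts for at most `#T ^ 3 ≤ 27` ordered triples; this crude count
suffices. -/
theorem rainbowSum_le_ncard [Fintype V] (C : SimpleGraph.TopEdgeLabeling V (Fin 3)) :
    rainbowSum (pairColor C) univ ≤ 27 * (rainbowTriangles C).ncard := by
  classical
  set S := univ.filter fun p : V × V × V => RainbowTriple (pairColor C) p.1 p.2.1 p.2.2 with hS
  have h1 : rainbowSum (pairColor C) univ = #S := by
    rw [rainbowSum, hS, ← sum_boole, Fintype.sum_prod_type]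
    refine sum_congr rfl fun x _ => ?_
    rw [Fintype.sum_prod_type]
  have h2 : #S ≤ 27 * #(S.image fun p => ({p.1, p.2.1, p.2.2} : Finset V)) := by
    refine card_le_mul_card_image S 27 fun T hT => ?_
    obtain ⟨q, -, rfl⟩ := mem_image.1 hT
    set T : Finset V := {q.1, q.2.1, q.2.2} with hT
    have h3 : #T ≤ 3 := card_le_three
    calc #(S.filter fun p => ({p.1, p.2.1, p.2.2} : Finset V) = T) ≤ #(T ×ˢ T ×ˢ T) := by
          refine card_le_card fun p hp => ?_
          rw [← (mem_filter.1 hp).2]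
          simp
      _ = #T * (#T * #T) := by rw [card_product, card_product]
      _ ≤ 3 * (3 * 3) := by gcongr
  have h3 : #(S.image fun p => ({p.1, p.2.1, p.2.2} : Finset V)) ≤ (rainbowTriangles C).ncard := by
    rw [← Set.ncard_coe_finset]
    refine Set.ncard_le_ncard ?_ (Set.toFinite _)
    intro T hT
    obtain ⟨p, hp, rfl⟩ := mem_image.1 (mem_coe.1 hT)
    exact (mem_filter.1 hp).2.mem_rainbowTriangles
  rw [h1]
  exact_mod_cast h2.trans (Nat.mul_le_mul_left 27 h3)

theorem exists_labeling_of_pairColor [Fintype V] (C : SimpleGraph.TopEdgeLabeling V (Fin 3))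
    {c' : V → V → Fin 3} (hc' : ∀ x y, c' x y = c' y x)
    (hr : ∀ x y z, ¬ RainbowTriple c' x y z) :
    ∃ C' : SimpleGraph.TopEdgeLabeling V (Fin 3), rainbowTriangles C' = ∅ ∧
      ((recoloredEdges C C').ncard : ℝ) ≤ diffSum (pairColor C) c' univ := by
  classical
  refine ⟨SimpleGraph.EdgeLabeling.mk (fun x y _ => c' x y) fun x y _ => hc' y x, ?_, ?_⟩
  · rw [Set.eq_empty_iff_forall_notMem]
    rintro T ⟨x, y, z, hxy, hyz, hxz, -, h⟩
    exact hr x y z h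
  · set D := univ.filter fun p : V × V => pairColor C p.1 p.2 ≠ c' p.1 p.2 with hD
    have h1 : diffSum (pairColor C) c' univ = #D := by
      rw [diffSum, hD, ← sum_boole, Fintype.sum_prod_type]
    rw [h1, ← Set.ncard_image_of_injective _ Subtype.val_injective]
    have h2 : Subtype.val '' recoloredEdges C
        (SimpleGraph.EdgeLabeling.mk (fun x y _ => c' x y) fun x y _ => hc' y x) ⊆
        (D.image (fun p => s(p.1, p.2)) : Finset (Sym2 V)) := by
      rintro _ ⟨⟨e, he⟩, hne, rfl⟩
      induction e using Sym2.inductionOn with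
      | hf x y =>
        refine mem_coe.2 (mem_image.2 ⟨(x, y), mem_filter.2 ⟨mem_univ _, ?_⟩, rfl⟩)
        rw [pairColor_of_adj C he]
        exact hne
    have h3 := Set.ncard_le_ncard h2 (Set.toFinite _)
    rw [Set.ncard_coe_finset] at h3
    exact_mod_cast h3.trans card_image_le

end EdgeLabeling

/-! ### Choice of constants and conclusion. -/

/-- With `k` about `ε⁻¹⁰` and cut density of order `ε ^ 3`, the failure probability is exponentially
small in a multiple of `ε⁻²`, which beats the factor `k + 1`. -/
theorem exists_sample_size {ε : ℝ} (hε : 0 < ε) (hε1 : ε ≤ 1 / 10 ^ 6) :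
    ∃ k : ℕ, 3 * (k + 1) * (1 - (ε ^ 3 / 25920) ^ 2) ^ k ≤ 1 / 4 ∧
      (k + 2 : ℝ) ≤ 2 * (1 / ε) ^ 10 := by
  set u : ℝ := 1 / ε with hu
  have hu6 : (10 : ℝ) ^ 6 ≤ u := by
    rw [hu, le_div_iff₀ hε]
    linarith
  have hu0 : 0 < u := by positivity
  have hεu : ε = 1 / u := by rw [hu, one_div_one_div]
  obtain ⟨k, hk1, hk2⟩ : ∃ k : ℕ, u ^ 10 ≤ k ∧ (k : ℝ) < u ^ 10 + 1 :=
    ⟨⌈u ^ 10⌉₊, Nat.le_ceil _, Nat.ceil_lt_add_one (by positivity)⟩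
  have hk3 : (k + 2 : ℝ) ≤ 2 * u ^ 10 := by
    have : (3 : ℝ) ≤ u ^ 10 := by
      calc (3 : ℝ) ≤ (10 ^ 6) ^ 10 := by norm_num
        _ ≤ u ^ 10 := by gcongr
    linarith
  refine ⟨k, ?_, hk3⟩
  set δ : ℝ := (ε ^ 3 / 25920) ^ 2 with hδ
  have hδ1 : δ ≤ 1 := by
    have h1 : ε ^ 3 / 25920 ≤ 1 := by
      have : ε ^ 3 ≤ 1 := pow_le_one₀ hε.le (by linarith)
      linarith
    exact pow_le_one₀ (by positivity) h1
  have hy : 1000 * u ^ 2 ≤ δ * k := by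
    have hd : δ = 1 / (25920 ^ 2 * u ^ 6) := by
      rw [hδ, hεu]
      field_simp
    calc 1000 * u ^ 2 ≤ u ^ 4 / 25920 ^ 2 := by
          rw [le_div_iff₀ (by norm_num)]
          have : (10 ^ 6 : ℝ) ^ 2 ≤ u ^ 2 := by gcongr
          calc 1000 * u ^ 2 * 25920 ^ 2 ≤ (10 ^ 6) ^ 2 * u ^ 2 := by nlinarith [sq_nonneg u]
            _ ≤ u ^ 2 * u ^ 2 := by gcongr
            _ = u ^ 4 := by ring
      _ = δ * u ^ 10 := by
          rw [hd]
          field_simp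
      _ ≤ δ * k := by
          gcongr
  have hexp : (1 - δ) ^ k ≤ Real.exp (-(δ * k)) := by
    calc (1 - δ) ^ k ≤ Real.exp (-δ) ^ k := by
          refine pow_le_pow_left₀ (by linarith) ?_ k
          have := Real.add_one_le_exp (-δ)
          linarith
      _ = Real.exp (-(δ * k)) := by
          rw [← Real.exp_nat_mul]
          ring_nf
  have hbig : 24 * u ^ 10 ≤ Real.exp (δ * k) := by
    have h1 : (0 : ℝ) ≤ 1000 * u ^ 2 := by positivity
    calc 24 * u ^ 10 ≤ (1000 * u ^ 2) ^ 6 / (Nat.factorial 6 : ℕ) := by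
          have : (Nat.factorial 6 : ℕ) = 720 := by decide
          rw [this]
          have h2 : (1 : ℝ) ≤ u ^ 2 := by nlinarith
          calc 24 * u ^ 10 ≤ 24 * u ^ 10 * u ^ 2 := le_mul_of_one_le_right (by positivity) h2
            _ = 24 * u ^ 12 := by ring
            _ ≤ (1000 ^ 6 / 720) * u ^ 12 := by gcongr; norm_num
            _ = _ := by push_cast; ring
      _ ≤ Real.exp (1000 * u ^ 2) := Real.pow_div_factorial_le_exp _ h1 6
      _ ≤ _ := Real.exp_le_exp.2 hy
  have hE := Real.exp_pos (δ * k)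
  calc 3 * (k + 1) * (1 - δ) ^ k ≤ 3 * (2 * u ^ 10) * Real.exp (-(δ * k)) := by
        gcongr
        linarith
    _ = 6 * u ^ 10 / Real.exp (δ * k) := by
        rw [Real.exp_neg]
        field_simp
        ring
    _ ≤ 1 / 4 := by
        rw [div_le_iff₀ hE]
        linarith

theorem exists_coloring_of_rainbowSum_le {V : Type*} [Fintype V] {c : V → V → Fin 3}
    (hc : ∀ x y, c x y = c y x) {ε : ℝ} (hε : 0 < ε) (hε1 : ε ≤ 1 / 10 ^ 6)
    (hn : 80 ≤ ε * Fintype.card V)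
    (hR : rainbowSum c univ ≤ 27 * (ε ^ 36 * (Fintype.card V : ℝ) ^ 3)) :
    ∃ c' : V → V → Fin 3, (∀ x y, c' x y = c' y x) ∧ (∀ x y z, ¬ RainbowTriple c' x y z) ∧
      diffSum c c' univ ≤ ε * (Fintype.card V : ℝ) ^ 2 := by
  obtain ⟨k, hk1, hk2⟩ := exists_sample_size hε hε1
  set n : ℝ := (Fintype.card V : ℝ) with hn_def
  have hn0 : 0 < n := pos_of_mul_pos_right (lt_of_lt_of_le (by norm_num) hn) hε.le
  have hpow : ∀ m : ℕ, ε ^ m ≤ 1 := fun m => pow_le_one₀ hε.le (by linarith)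
  -- The choices are `η = ε / 20`, `κ = ε ^ 2 / 2880`, `θ = ε ^ 3 / 25920`, `a = ε / 3` and `b = 1 /
  -- (ε ^ 34 * n)`. The three potentials then cost at most `ε / 3`, `ε / 3` and `ε / 4` times `n ^
  -- 2`.
  have hη : 0 < ε / 20 := by positivity
  have hκ : 0 < ε ^ 2 / 2880 := by positivity
  have hθ : 0 < ε ^ 3 / 25920 := by positivity
  have ha : ε ^ 3 / 25920 * (1 / (ε ^ 2 / 2880) + 5 + 8 * ((2 * (ε ^ 2 / 2880) + ε ^ 3 / 25920) /
      (ε ^ 3 / 25920 * (ε / 20)))) ≤ ε / 3 := by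
    have e : ε ^ 3 / 25920 * (1 / (ε ^ 2 / 2880) + 5 + 8 * ((2 * (ε ^ 2 / 2880) + ε ^ 3 / 25920) /
      (ε ^ 3 / 25920 * (ε / 20)))) =
      ε * (2 / 9) + ε * (5 / 25920 * ε ^ 2 + 160 / 25920 * ε) := by
      field_simp
      ring
    rw [e]
    have h1 := hpow 2
    have h2 : 5 / 25920 * ε ^ 2 + 160 / 25920 * ε ≤ 1 / 9 := by linarith
    have h3 := mul_le_mul_of_nonneg_left h2 hε.le
    linarith
  have hb : 16 / (ε ^ 3 / 25920 * (ε / 20 * n)) ≤ 1 / (ε ^ 34 * n) := by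
    rw [div_le_div_iff₀ (by positivity) (by positivity)]
    have h1 : ε ^ 30 ≤ 1 / (16 * 25920 * 20) := by
      calc ε ^ 30 ≤ ε ^ 2 := pow_le_pow_of_le_one hε.le (by linarith) (by norm_num)
        _ ≤ (1 / 10 ^ 6) ^ 2 := by gcongr
        _ ≤ _ := by norm_num
    calc 16 * (ε ^ 34 * n) = 16 * n * ε ^ 4 * ε ^ 30 := by ring
      _ ≤ 16 * n * ε ^ 4 * (1 / (16 * 25920 * 20)) := by gcongr
      _ = _ := by ring
  -- The exponent arises here: the cubed sample size costs `ε⁻³⁰` and the minimal block size one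
  -- more factor `ε⁻¹`; the slack up to `ε⁻³⁴` absorbs the constants.
  have hbk : 2 * (k + 2) ^ 3 / (ε / 20 * n) ≤ 1 / (ε ^ 34 * n) := by
    rw [div_le_div_iff₀ (by positivity) (by positivity)]
    have h1 : (k + 2 : ℝ) ^ 3 ≤ (2 * (1 / ε) ^ 10) ^ 3 := by gcongr
    have h2 : ε ^ 3 ≤ 1 / 320 := by
      calc ε ^ 3 ≤ ε ^ 1 := pow_le_pow_of_le_one hε.le (by linarith) (by norm_num)
        _ ≤ _ := by linarith
    calc 2 * (k + 2 : ℝ) ^ 3 * (ε ^ 34 * n) ≤ 2 * (2 * (1 / ε) ^ 10) ^ 3 * (ε ^ 34 * n) := by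
          gcongr
      _ = 16 * ε * n * ε ^ 3 := by
          field_simp
          ring
      _ ≤ 16 * ε * n * (1 / 320) := by gcongr
      _ = _ := by ring
  obtain ⟨c', h1, h2, h3⟩ := exists_coloring_diffSum_le hc hη hκ hθ
    (by have := hpow 3; linarith) (by positivity : (0 : ℝ) ≤ ε / 3) ha hb hk1 hbk
    (by linarith) univ
  refine ⟨c', h1, fun x y z => h2 x (mem_univ _) y (mem_univ _) z (mem_univ _), h3.trans ?_⟩
  rw [card_univ, ← hn_def]
  have h4 : 1 / (ε ^ 34 * n) * rainbowSum c univ ≤ ε / 3 * n ^ 2 := by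
    calc 1 / (ε ^ 34 * n) * rainbowSum c univ ≤
          1 / (ε ^ 34 * n) * (27 * (ε ^ 36 * n ^ 3)) := by gcongr
      _ = 27 * ε * (ε * n ^ 2) := by field_simp
      _ ≤ 1 / 3 * (ε * n ^ 2) := by gcongr; linarith
      _ = _ := by ring
  have h5 : 0 ≤ ε * n ^ 2 := by positivity
  have h6 : 5 * (ε / 20) * n * n = ε * n ^ 2 / 4 := by ring
  linarith

theorem mainTheorem3 :
    ∃ ε₀ : ℝ, 0 < ε₀ ∧ ∀ ε : ℝ, 0 < ε → ε ≤ ε₀ →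
      ∀ (V : Type*) [Fintype V] (C : SimpleGraph.TopEdgeLabeling V (Fin 3)),
        ((rainbowTriangles C).ncard : ℝ) ≤ ε ^ 36 * (Fintype.card V : ℝ) ^ 3 →
        ∃ C' : SimpleGraph.TopEdgeLabeling V (Fin 3),
          rainbowTriangles C' = ∅ ∧
          ((recoloredEdges C C').ncard : ℝ) ≤ ε * (Fintype.card V : ℝ) ^ 2 := by
  refine ⟨1 / 10 ^ 6, by norm_num, fun ε hε hε1 V _ C hC => ?_⟩
  by_cases h0 : rainbowTriangles C = ∅
  · refine ⟨C, h0, ?_⟩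
    have : recoloredEdges C C = ∅ := by simp [recoloredEdges]
    rw [this, Set.ncard_empty, Nat.cast_zero]
    positivity
  · have h1 : 1 ≤ (rainbowTriangles C).ncard :=
      (Set.ncard_pos (Set.toFinite _)).2 (Set.nonempty_iff_ne_empty.2 h0)
    -- A single rainbow triangle already forces `ε ^ 12 * n ≥ 1`, so the vertex set is as large as
    -- the recursion needs.
    have h2 : (1 : ℝ) ≤ (ε ^ 12 * Fintype.card V) ^ 3 := by
      calc (1 : ℝ) ≤ (rainbowTriangles C).ncard := by exact_mod_cast h1
        _ ≤ _ := hC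
        _ = _ := by ring
    have h3 : (1 : ℝ) ≤ ε ^ 12 * Fintype.card V := by
      by_contra! h
      exact absurd h2 (not_le.2 (pow_lt_one₀ (by positivity) h (by norm_num)))
    have h4 : 80 ≤ ε * Fintype.card V := by
      have h5 : ε ^ 11 ≤ 1 / 80 := by
        calc ε ^ 11 ≤ ε ^ 1 := pow_le_pow_of_le_one hε.le (by linarith) (by norm_num)
          _ ≤ _ := by linarith
      have h6 : ε ^ 12 * Fintype.card V ≤ 1 / 80 * (ε * Fintype.card V) := by
        calc ε ^ 12 * Fintype.card V = ε ^ 11 * (ε * Fintype.card V) := by ring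
          _ ≤ _ := by gcongr
      linarith
    obtain ⟨c', hc', hr, hd⟩ := exists_coloring_of_rainbowSum_le (pairColor_comm C) hε hε1 h4
      ((rainbowSum_le_ncard C).trans (by gcongr))
    obtain ⟨C', hC'1, hC'2⟩ := exists_labeling_of_pairColor C hc' hr
    exact ⟨C', hC'1, hC'2.trans hd⟩
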